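/- Let $d\in\mathbb{N}_0$, $D:=d+2$. On $\mathbb{R}^{1+d}\ni x=(x_0,\dots,x_d)$ let $L:=\partial_0-\sum_{i=1}^d\partial_i^2$, let $\mathcal{S}$ be the space of real-valued Schwartz functions (with its usual topology and Borel $\sigma$-algebra), and call a continuous linear form on $\mathcal{S}$ a distribution. For $r>0$ and $\psi\in\mathcal{S}$ put $\psi_r(x):=r^{-D}\psi(r^{-2}x_0,r^{-1}x_1,\dots,r^{-1}x_d)$, and for a distribution $F$ put $F*\psi(0):=(F,\psi(-\,\cdot))$. The parabolic degree of a monomial $x^{\mathbf n}$ is $2n_0+n_1+\dots+n_d$, and a polynomial of degree $\le m$ with $m<0$ is $0$. The relation "$Lu=f$ modulo a polynomial of degree $\le m$" means that $Lu=f+p$ in the sense of distributions for some polynomial $p$ of parabolic degree $\le m$. There is a family $(\mu_{[\psi,r,\kappa]})_{\psi\in\mathcal{S},\,r>0,\,\kappa\in\mathbb{R}\setminus\mathbb{N}_0}$ of (non-negative Borel) measures on $\mathcal{S}\times(0,\infty)$ with the following properties. (Representation) Let $\kappa\in\mathbb{R}\setminus\mathbb{N}_0$. For each bounded set $\mathcal{B}\subset\mathcal{S}$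 there is a bounded Borel set $\tilde{\mathcal{B}}\subset\mathcal{S}$ such that both of the following hold. (i) Let $u,f$ be distributions such that $Lu=f$ modulo a polynomial of degree $\le\kappa-2$ and $$\sup_{r>0}r^{2-\kappa}|f*\psi_r(0)|<\infty,\qquad \sup_{r>0}r^{-\kappa}|u*\psi_r(0)|<\infty,$$ uniformly over $\psi$ in bounded subsets of $\mathcal{S}$. Then for all $\psi\in\mathcal{B}$ and $r>0$ $$u*\psi_r(0)=\int_{\tilde{\mathcal{B}}\times(0,\infty)}f*\tilde\psi_{\tilde r}(0)\,d\mu_{[\psi,r,\kappa]}(\tilde\psi,\tilde r),\qquad(*)$$ where the integral converges absolutely. (ii) Let $u,f$ be random distributions on a probability space (that is, $(u,\zeta)$ and $(f,\zeta)$ are random variables for every $\zeta\in\mathcal{S}$) such that almost surely $Lu=f$ modulo a (random) polynomial of degree $\le\kappa-2$, and such that for some $p\in(1,\infty)$ $$\sup_{r>0}r^{2-\kappa}\,\mathbb{E}^{\frac1p}|f*\psi_r(0)|^p<\infty,\qquad \sup_{r>0}r^{-\kappa}\,\mathbb{E}^{\frac1p}|u*\psi_r(0)|^p<\infty,$$ uniformly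 over $\psi$ in bounded subsets of $\mathcal{S}$. Then almost surely $(*)$ holds, with an absolutely convergent integral, for all $\psi\in\mathcal{B}$ and $r>0$. (Moment bounds) For all $\kappa,\tilde\kappa\in\mathbb{R}\setminus\mathbb{N}_0$ with $\lfloor\tilde\kappa\rfloor=\lfloor\kappa\rfloor$, in particular for $\tilde\kappa=\kappa$, and for each bounded $\mathcal{B}\subset\mathcal{S}$ there is a constant $C$ such that $$\int_{\mathcal{S}\times(0,\infty)}\tilde r^{\tilde\kappa-2}\,d\mu_{[\psi,r,\kappa]}(\tilde\psi,\tilde r)\le C\,r^{\tilde\kappa}\qquad\text{for all }\psi\in\mathcal{B},\ r>0.$$ (Dependence on $\kappa$) $\mu_{[\psi,r,\kappa]}$ depends on $\kappa$ only through $\lfloor\kappa\rfloor$: for $\kappa,\tilde\kappa\in\mathbb{R}\setminus\mathbb{N}_0$ with $\lfloor\kappa\rfloor=\lfloor\tilde\kappa\rfloor$ one has $\mu_{[\psi,r,\kappa]}=\mu_{[\psi,r,\tilde\kappa]}$ for all $\psi\in\mathcal{S}$, $r>0$. -/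

import Mathlib

open scoped SchwartzMap LineDeriv
open MeasureTheory

namespace AbstractIntegration

noncomputable section

/-- Space-time `ℝ^{1+d}`; the coordinate `0` is the time-like one. -/
abbrev SpaceTime (d : ℕ) : Type := EuclideanSpace ℝ (Fin (d + 1))

/-- The space of (real-valued) Schwartz functions on space-time. -/
abbrev Schw (d : ℕ) : Type := 𝓢(SpaceTime d, ℝ)

/-- Schwartz distributions: continuous linear forms on the space of Schwartz functions. -/
abbrev Distr (d : ℕ) : Type := Schw d →L[ℝ] ℝ

/-- The space of Schwartz functions carries the Borel `σ`-algebra of its usual topology. -/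
instance instMeasurableSpaceSchw (d : ℕ) : MeasurableSpace (Schw d) := borel (Schw d)

instance instBorelSpaceSchw (d : ℕ) : BorelSpace (Schw d) := ⟨rfl⟩

/-- Length scales `r ∈ (0,∞)`. -/
abbrev Scale : Type := Set.Ioi (0 : ℝ)

/-- Parabolic weights of the coordinates: `2` for time, `1` for space. -/
def weight {d : ℕ} (i : Fin (d + 1)) : ℕ := if i = 0 then 2 else 1

/-- The parabolic dilation `R x = (r² x₀, r x₁, …, r x_d)`. -/
def dilation (d : ℕ) (r : Scale) : SpaceTime d ≃L[ℝ] SpaceTime d :=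
  LinearEquiv.toContinuousLinearEquiv
    { toFun := fun x => WithLp.toLp 2 fun i => (r : ℝ) ^ weight i * x i
      invFun := fun x => WithLp.toLp 2 fun i => ((r : ℝ) ^ weight i)⁻¹ * x i
      map_add' := fun x y => by ext i; simp [mul_add]
      map_smul' := fun c x => by ext i; simp [mul_left_comm]
      left_inv := fun x => by
        ext i
        have hr : (r : ℝ) ≠ 0 := ne_of_gt r.2
        simp [hr]
      right_inv := fun x => by
        ext i
        have hr : (r : ℝ) ≠ 0 := ne_of_gt r.2
        simp [hr] }

/-- The parabolic rescaling `ψ_r = r^{-D} ψ(R⁻¹ ·)`, where `D = d + 2`. -/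
def rescale {d : ℕ} (r : Scale) (ψ : Schw d) : Schw d :=
  ((r : ℝ) ^ (d + 2))⁻¹ • SchwartzMap.compCLMOfContinuousLinearEquiv ℝ (dilation d r).symm ψ

/-- The value at the origin of the convolution of a distribution with a Schwartz function,
`F * φ (0) = (F, φ(0 - ·))`. -/
def convZero {d : ℕ} (F : Distr d) (φ : Schw d) : ℝ :=
  F (SchwartzMap.compCLMOfContinuousLinearEquiv ℝ (ContinuousLinearEquiv.neg ℝ) φ)

theorem rescale_apply {d : ℕ} (r : Scale) (ψ : Schw d) (x : SpaceTime d) :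
    rescale r ψ x
      = ((r : ℝ) ^ (d + 2))⁻¹ * ψ (WithLp.toLp 2 fun i => ((r : ℝ) ^ weight i)⁻¹ * x i) := rfl

/-- The `i`-th unit vector of space-time. -/
def unitVec {d : ℕ} (i : Fin (d + 1)) : SpaceTime d := EuclideanSpace.single i 1

/-- `L* ζ = -∂₀ ζ - ∑_{i=1}^d ∂ᵢ² ζ`, the formal adjoint of the heat operator
`L = ∂₀ - ∑_{i=1}^d ∂ᵢ²`. -/
def heatAdjoint {d : ℕ} (ζ : Schw d) : Schw d :=
  -(∂_{unitVec (d := d) 0} ζ)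
    - ∑ i : Fin d, ∂_{unitVec (d := d) i.succ} (∂_{unitVec (d := d) i.succ} ζ)

/-- The parabolic order `|𝐧| = 2 n₀ + n₁ + ⋯ + n_d` of a multi-index. -/
def parabolicOrder {d : ℕ} (n : Fin (d + 1) →₀ ℕ) : ℕ := ∑ i, weight i * n i

/-- `L u = f` modulo a polynomial of parabolic degree `≤ m`, in the sense of distributions.
For `m < 0` the polynomial has to vanish. -/
def SolvesModPoly {d : ℕ} (m : ℝ) (u f : Distr d) : Prop :=
  ∃ p : MvPolynomial (Fin (d + 1)) ℝ, (∀ n ∈ p.support, (parabolicOrder n : ℝ) ≤ m) ∧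
    ∀ ζ : Schw d, u (heatAdjoint ζ)
      = f ζ + ∫ x : SpaceTime d, MvPolynomial.eval (fun i => x i) p * ζ x

/-- `sup_{r > 0} r^{-a} |F * ψ_r (0)| < ∞`, uniformly over `ψ` in bounded sets. -/
def ScalingBound {d : ℕ} (a : ℝ) (F : Distr d) : Prop :=
  ∀ B : Set (Schw d), Bornology.IsVonNBounded ℝ B →
    ∃ C : ℝ, ∀ ψ ∈ B, ∀ r : Scale, (r : ℝ) ^ (-a) * |convZero F (rescale r ψ)| ≤ C

/-- A random Schwartz distribution: every pairing with a Schwartz function is a random variable. -/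
def IsRandomDistr {d : ℕ} {Ω : Type*} [MeasurableSpace Ω] (F : Ω → Distr d) : Prop :=
  ∀ ζ : Schw d, Measurable fun ω => F ω ζ

/-- `sup_{r > 0} r^{-a} 𝔼^{1/p} |F * ψ_r (0)|^p < ∞`, uniformly over `ψ` in bounded sets. -/
def AnnealedScalingBound {d : ℕ} {Ω : Type*} [MeasurableSpace Ω] (P : Measure Ω) (p a : ℝ)
    (F : Ω → Distr d) : Prop :=
  ∀ B : Set (Schw d), Bornology.IsVonNBounded ℝ B →
    ∃ C : ℝ, ∀ ψ ∈ B, ∀ r : Scale,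
      ENNReal.ofReal ((r : ℝ) ^ (-a)) *
          (∫⁻ ω, ENNReal.ofReal (|convZero (F ω) (rescale r ψ)| ^ p) ∂P) ^ (1 / p)
        ≤ ENNReal.ofReal C

/-- The representation
`u * ψ_r (0) = ∫_{B' × (0,∞)} f * ψ'_{r'} (0) dμ_{[ψ,r]}(ψ', r')` for all `ψ ∈ B` and `r > 0`,
where the integral on the right-hand side converges absolutely. -/
def Representation {d : ℕ} (μ : Schw d → Scale → Measure (Schw d × Scale))
    (B B' : Set (Schw d)) (u f : Distr d) : Prop :=
  ∀ ψ ∈ B, ∀ r : Scale,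
    IntegrableOn (fun q : Schw d × Scale => convZero f (rescale q.2 q.1))
        (B' ×ˢ Set.univ) (μ ψ r) ∧
      convZero u (rescale r ψ)
        = ∫ q in B' ×ˢ Set.univ, convZero f (rescale q.2 q.1) ∂(μ ψ r)

end

end AbstractIntegration

/-!
The kernel `η` is a Schwartz function whose Fourier transform equals one near the origin. Its dyadic
difference `η - η_2` has a Fourier transform that is compactly supported away from the origin, where
the symbol of the heat operator does not vanish, so that `η - η_2 = L χ` for a Schwartz function `χ`,
the potential (`heat_potential`). The Fourier transform of `χ` vanishes near the origin, hence `χ`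
annihilates all polynomials. If `L u = f` modulo a polynomial and `T` is convolution with a Schwartz
function, a derivative, or a combination of these, this gives
`u * (T η_r) - u * (T η_{2r}) = r² f * (T χ_r)` at the origin (`apply_kernel_sub_apply_kernel`): the
difference on the left is a test of `f`, and such identities can be summed over dyadic scales.

Let `W = ⌊κ⌋ + 1`, or `W = 0` for `κ < 0`, and split `ψ` into the three parts
`ψ - ψ * η`, the remainder `R η` of the parabolic Taylor expansion of the operator `ψ * ·` to order
`W` (`taylorRem`), and the Taylor terms, which are multiples of `∂_s η` with `|s| < W`, that is with
`|s| < κ`. The first part telescopes over small scales, since `ψ * η_r → ψ` for `r → 0`. The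
remainder telescopes over large scales, since `R η_r` is `r^{-W}` times the rescaling of a bounded
family of Schwartz functions (`isVonNBounded_taylorRem`), so that `u * (R η_r) = O(r^{κ-W}) → 0` for
`r → ∞`. The Taylor terms telescope over small scales again, since
`u * (∂_s η_r) = O(r^{κ-|s|}) → 0` for `r → 0`; here it matters that `κ` is
not a nonnegative integer.
Altogether `u * ψ` is a series of tests of `f` (`hasSum_atomTerm`) with functions from a bounded set
(`isVonNBounded_atoms`), at dyadic scales and with weights whose moment of homogeneity `κ - 2` is
finite (`summable_atomWeight`). The representing measure is the corresponding superposition of Dirac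
masses, transported from scales in `(1/2, 1]` to all scales by powers of two.

In the annealed setting the formula has to hold almost surely for all test functions of a bounded
set at once. By `exists_uniform_domination`, a quantitative form of the nuclearity of Schwartz
space, bounds on the moments of a random distribution, uniform over bounded sets of test functions,
imply bounds on the moments of its suprema over bounded sets. Hence the expected sum of the series,
with the supremum over the test functions taken inside, is finite, and the boundary terms, which have
summable expectations, tend to zero almost surely. The deterministic statement is the annealed one
on a one-point probability space.
-/

namespace AbstractIntegration

noncomputable section

open FourierTransform Filter Topology
open scoped ENNReal BoundedContinuousFunction

variable {d : ℕ}

/-! ### Derivatives along words and bounded sets of Schwartz functions -/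

/-- The partial derivative `∂ᵢ` on Schwartz functions. -/
def partialD (i : Fin (d + 1)) : Schw d →L[ℝ] Schw d :=
  LineDeriv.lineDerivOpCLM ℝ (Schw d) (unitVec i)

/-- The iterated partial derivative along a word `s` in the coordinate indices. Words stand in for
multi-indices: they make recursions over derivatives structural. -/
def wordD : List (Fin (d + 1)) → Schw d →L[ℝ] Schw d
  | [] => .id ℝ _
  | i :: s => (wordD s).comp (partialD i)

/-- The parabolic order of a word. -/
def order (s : List (Fin (d + 1))) : ℕ := (s.map weight).sum

@[simp] theorem wordD_nil (φ : Schw d) : wordD [] φ = φ := rfl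

theorem wordD_cons (i : Fin (d + 1)) (s : List (Fin (d + 1))) (φ : Schw d) :
    wordD (i :: s) φ = wordD s (partialD i φ) := rfl

@[simp] theorem order_nil : order ([] : List (Fin (d + 1))) = 0 := rfl

@[simp] theorem order_cons (i : Fin (d + 1)) (s : List (Fin (d + 1))) :
    order (i :: s) = weight i + order s := by simp [order]

theorem one_le_weight (i : Fin (d + 1)) : 1 ≤ weight i := by
  unfold weight; split <;> norm_num

theorem partialD_apply (i : Fin (d + 1)) (φ : Schw d) (x : SpaceTime d) :
    partialD i φ x = fderiv ℝ φ x (unitVec i) :=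
  SchwartzMap.lineDerivOp_apply_eq_fderiv _ _ _

theorem partialD_comm (i j : Fin (d + 1)) (φ : Schw d) :
    partialD i (partialD j φ) = partialD j (partialD i φ) := by
  have key : ∀ i j : Fin (d + 1), ∀ x, partialD i (partialD j φ) x
      = fderiv ℝ (fderiv ℝ φ) x (unitVec i) (unitVec j) := by
    intro i j x
    rw [partialD_apply]
    have h : (partialD j φ : SpaceTime d → ℝ) = fun y => fderiv ℝ φ y (unitVec j) := by
      ext y; exact partialD_apply _ _ _
    have hd : DifferentiableAt ℝ (fderiv ℝ φ) x :=
      ((φ.smooth 2).fderiv_right (m := 1) (by norm_num)).differentiable (by norm_num) x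
    rw [h, fderiv_clm_apply hd (differentiableAt_const _)]
    simp
  ext x
  rw [key, key]
  have hs : IsSymmSndFDerivAt ℝ φ x :=
    (φ.smooth 2).contDiffAt.isSymmSndFDerivAt (by simp)
  exact hs _ _

theorem wordD_partialD (s : List (Fin (d + 1))) (i : Fin (d + 1)) (φ : Schw d) :
    wordD s (partialD i φ) = partialD i (wordD s φ) := by
  induction s generalizing φ with
  | nil => rfl
  | cons j s ih => rw [wordD_cons, wordD_cons, partialD_comm, ih]

theorem norm_le_sum_apply_unitVec {n : ℕ}
    (f : ContinuousMultilinearMap ℝ (fun _ : Fin n => SpaceTime d) ℝ) :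
    ‖f‖ ≤ ∑ r : Fin n → Fin (d + 1), |f fun j => unitVec (r j)| := by
  refine f.opNorm_le_bound (Finset.sum_nonneg fun _ _ => abs_nonneg _) fun m => ?_
  have hm : m = fun j => ∑ i, m j i • unitVec (d := d) i := by
    ext j k
    simp [unitVec, Pi.single_apply]
  conv_lhs => rw [hm]
  rw [ContinuousMultilinearMap.map_sum]
  refine (norm_sum_le _ _).trans ?_
  rw [Finset.sum_mul]
  refine Finset.sum_le_sum fun r _ => ?_
  rw [ContinuousMultilinearMap.map_smul_univ, norm_smul, mul_comm, Real.norm_eq_abs, norm_prod]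
  gcongr with j
  exact PiLp.norm_apply_le (m j) (r j)

/-- Iterated Fréchet derivatives in coordinate directions are derivatives along words. The
existential form spares the translation between tuples and lists. -/
theorem iteratedFDeriv_unitVec_eq_wordD {n : ℕ} (r : Fin n → Fin (d + 1)) :
    ∃ s : List (Fin (d + 1)), ∀ (φ : Schw d) (x : SpaceTime d),
      iteratedFDeriv ℝ n φ x (fun j => unitVec (r j)) = wordD s φ x := by
  suffices h : ∃ s : List (Fin (d + 1)), ∀ φ : Schw d,
      ∂^{fun j => unitVec (d := d) (r j)} φ = wordD s φ by
    obtain ⟨s, hs⟩ := h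
    exact ⟨s, fun φ x => by rw [← hs, SchwartzMap.iteratedLineDerivOp_eq_iteratedFDeriv]⟩
  induction n with
  | zero => exact ⟨[], fun φ => by simp⟩
  | succ n ih =>
    obtain ⟨s, hs⟩ := ih (fun j => r j.succ)
    refine ⟨r 0 :: s, fun φ => ?_⟩
    rw [LineDeriv.iteratedLineDerivOp_succ_left, wordD_cons, wordD_partialD, ← hs]
    rfl

/-- Boundedness in Schwartz space, tested by weighted supremum bounds on all iterated partial
derivatives. -/
theorem isVonNBounded_iff_wordD {A : Set (Schw d)} :
    Bornology.IsVonNBounded ℝ A ↔ ∀ (s : List (Fin (d + 1))) (N : ℕ), ∃ C : ℝ,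
      ∀ φ ∈ A, ∀ x, (1 + ‖x‖) ^ N * |wordD s φ x| ≤ C := by
  constructor
  · intro hA s N
    have h1 : Bornology.IsVonNBounded ℝ (wordD s '' A) := hA.image (wordD s)
    rw [(schwartz_withSeminorms ℝ (SpaceTime d) ℝ).isVonNBounded_iff_finset_seminorm_bounded] at h1
    obtain ⟨r, -, hr⟩ := h1 (Finset.Iic (N, 0))
    refine ⟨2 ^ N * r, fun φ hφ x => ?_⟩
    have h2 := SchwartzMap.one_add_le_sup_seminorm_apply (𝕜 := ℝ) (m := (N, 0)) (k := N) (n := 0)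
      le_rfl le_rfl (wordD s φ) x
    simp only [norm_iteratedFDeriv_zero, Real.norm_eq_abs] at h2
    refine h2.trans ?_
    gcongr
    exact (hr _ (Set.mem_image_of_mem _ hφ)).le
  · intro h
    rw [(schwartz_withSeminorms ℝ (SpaceTime d) ℝ).isVonNBounded_iff_seminorm_bounded]
    rintro ⟨k, n⟩
    choose S hS using fun r : Fin n → Fin (d + 1) => iteratedFDeriv_unitVec_eq_wordD r
    choose C hC using h
    refine ⟨|∑ r, C (S r) k| + 1, by positivity, fun φ hφ => ?_⟩
    refine lt_of_le_of_lt ?_ (lt_add_one _)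
    refine SchwartzMap.seminorm_le_bound ℝ k n φ (abs_nonneg _) fun x => ?_
    calc ‖x‖ ^ k * ‖iteratedFDeriv ℝ n φ x‖
        ≤ (1 + ‖x‖) ^ k * ∑ r : Fin n → Fin (d + 1), |wordD (S r) φ x| := by
          gcongr
          · linarith [norm_nonneg x]
          · refine (norm_le_sum_apply_unitVec _).trans_eq ?_
            exact Finset.sum_congr rfl fun r _ => by rw [hS]
      _ = ∑ r : Fin n → Fin (d + 1), (1 + ‖x‖) ^ k * |wordD (S r) φ x| := Finset.mul_sum _ _ _
      _ ≤ ∑ r, C (S r) k := Finset.sum_le_sum fun r _ => hC _ _ _ hφ x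
      _ ≤ _ := le_abs_self _

/-- Pointwise decay, uniform over a bounded set. -/
theorem exists_decay_of_isVonNBounded {A : Set (Schw d)} (hA : Bornology.IsVonNBounded ℝ A)
    (N : ℕ) : ∃ C : ℝ, 0 ≤ C ∧ ∀ φ ∈ A, ∀ x, (1 + ‖x‖) ^ N * |φ x| ≤ C := by
  obtain ⟨C, hC⟩ := isVonNBounded_iff_wordD.1 hA [] N
  exact ⟨max C 0, le_max_right _ _, fun φ hφ x => (hC φ hφ x).trans (le_max_left _ _)⟩

theorem exists_decay (φ : Schw d) (N : ℕ) :
    ∃ C : ℝ, 0 ≤ C ∧ ∀ x, (1 + ‖x‖) ^ N * |φ x| ≤ C := by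
  obtain ⟨C, h0, hC⟩ := exists_decay_of_isVonNBounded (Bornology.isVonNBounded_singleton φ) N
  exact ⟨C, h0, hC φ rfl⟩

/-! ### Parabolic rescaling -/

theorem dilation_apply (r : Scale) (x : SpaceTime d) (i : Fin (d + 1)) :
    dilation d r x i = (r : ℝ) ^ weight i * x i := rfl

theorem dilation_symm_apply (r : Scale) (x : SpaceTime d) (i : Fin (d + 1)) :
    (dilation d r).symm x i = ((r : ℝ) ^ weight i)⁻¹ * x i := rfl

theorem rescale_apply' (r : Scale) (ψ : Schw d) (x : SpaceTime d) :
    rescale r ψ x = ((r : ℝ) ^ (d + 2))⁻¹ * ψ ((dilation d r).symm x) := rfl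

theorem prod_pow_weight (r : ℝ) : ∏ i : Fin (d + 1), r ^ weight i = r ^ (d + 2) := by
  rw [Fin.prod_univ_succ]
  simp [weight, pow_add, mul_comm]

theorem det_dilation (r : Scale) :
    LinearMap.det ((dilation d r : SpaceTime d ≃L[ℝ] SpaceTime d) : SpaceTime d →ₗ[ℝ] SpaceTime d)
      = (r : ℝ) ^ (d + 2) := by
  rw [← LinearMap.det_toMatrix (EuclideanSpace.basisFun (Fin (d + 1)) ℝ).toBasis]
  rw [← prod_pow_weight, ← Matrix.det_diagonal]
  congr 1
  ext i j
  rw [LinearMap.toMatrix_apply]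
  by_cases h : i = j
  · subst h; simp [dilation_apply]
  · simp [dilation_apply, h]

/-- Parabolic change of variables. -/
theorem integral_comp_dilation {F : Type*} [NormedAddCommGroup F] [NormedSpace ℝ F] (r : Scale)
    (f : SpaceTime d → F) :
    ∫ x, f (dilation d r x) = ((r : ℝ) ^ (d + 2))⁻¹ • ∫ x, f x := by
  have hr : (0 : ℝ) < (r : ℝ) ^ (d + 2) := pow_pos r.2 _
  have h := Measure.map_linearMap_addHaar_eq_smul_addHaar (volume : Measure (SpaceTime d))
    (f := ((dilation d r : SpaceTime d ≃L[ℝ] SpaceTime d) : SpaceTime d →ₗ[ℝ] SpaceTime d))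
    (by rw [det_dilation]; exact hr.ne')
  rw [det_dilation] at h
  have h2 := (dilation d r).toHomeomorph.measurableEmbedding.integral_map
    (μ := (volume : Measure (SpaceTime d))) f
  have h3 : Measure.map (dilation d r).toHomeomorph (volume : Measure (SpaceTime d))
      = ENNReal.ofReal |((r : ℝ) ^ (d + 2))⁻¹| • volume := h
  rw [h3, integral_smul_measure, abs_of_pos (inv_pos.2 hr),
    ENNReal.toReal_ofReal (inv_pos.2 hr).le] at h2
  exact h2.symm

theorem integral_comp_dilation_symm {F : Type*} [NormedAddCommGroup F] [NormedSpace ℝ F]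
    (r : Scale) (f : SpaceTime d → F) :
    ∫ x, f ((dilation d r).symm x) = ((r : ℝ) ^ (d + 2)) • ∫ x, f x := by
  have hr : (0 : ℝ) < (r : ℝ) ^ (d + 2) := pow_pos r.2 _
  have h := integral_comp_dilation r fun x => f ((dilation d r).symm x)
  simp only [ContinuousLinearEquiv.symm_apply_apply] at h
  rw [h, smul_smul, mul_inv_cancel₀ hr.ne', one_smul]

/-- The rescaling operator as a continuous linear map. -/
def rescaleL (r : Scale) : Schw d →L[ℝ] Schw d :=
  ((r : ℝ) ^ (d + 2))⁻¹ • SchwartzMap.compCLMOfContinuousLinearEquiv ℝ (dilation d r).symm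

@[simp] theorem rescaleL_apply (r : Scale) (ψ : Schw d) : rescaleL r ψ = rescale r ψ := rfl

theorem rescale_rescale {r s t : Scale} (h : (t : ℝ) = r * s) (ψ : Schw d) :
    rescale r (rescale s ψ) = rescale t ψ := by
  ext x
  simp only [rescale_apply, ← mul_assoc, h, mul_pow, mul_inv]
  congr 2
  ext i
  simp [mul_comm]

theorem rescale_one {r : Scale} (hr : (r : ℝ) = 1) (ψ : Schw d) : rescale r ψ = ψ := by
  ext x
  simp [rescale_apply, hr]

theorem partialD_rescale (r : Scale) (i : Fin (d + 1)) (ψ : Schw d) :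
    partialD i (rescale r ψ) = ((r : ℝ) ^ weight i)⁻¹ • rescale r (partialD i ψ) := by
  have h : (dilation d r).symm (unitVec i) = ((r : ℝ) ^ weight i)⁻¹ • unitVec (d := d) i := by
    ext j
    rw [dilation_symm_apply]
    by_cases hij : j = i
    · subst hij; simp [unitVec]
    · simp [unitVec, hij]
  change ∂_{unitVec (d := d) i} (((r : ℝ) ^ (d + 2))⁻¹ •
    SchwartzMap.compCLMOfContinuousLinearEquiv ℝ (dilation d r).symm ψ) = _
  rw [LineDeriv.lineDerivOp_smul, SchwartzMap.lineDerivOp_compCLMOfContinuousLinearEquiv, h,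
    LineDeriv.lineDerivOp_left_smul, map_smul, smul_comm]
  rfl

theorem wordD_rescale (r : Scale) (s : List (Fin (d + 1))) (ψ : Schw d) :
    wordD s (rescale r ψ) = ((r : ℝ) ^ order s)⁻¹ • rescale r (wordD s ψ) := by
  induction s generalizing ψ with
  | nil => simp
  | cons i s ih =>
    rw [wordD_cons, partialD_rescale, map_smul, ih, wordD_cons, smul_smul, order_cons, pow_add,
      mul_inv]

/-! ### Convolution of real Schwartz functions -/

/-- Complexification of real Schwartz functions. -/
def toC : Schw d →L[ℝ] 𝓢(SpaceTime d, ℂ) := SchwartzMap.postcompCLM Complex.ofRealCLM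

/-- The real part of a complex Schwartz function. -/
def reC : 𝓢(SpaceTime d, ℂ) →L[ℝ] Schw d := SchwartzMap.postcompCLM Complex.reCLM

@[simp] theorem toC_apply (ψ : Schw d) (x : SpaceTime d) : toC ψ x = (ψ x : ℂ) := rfl

@[simp] theorem reC_apply (h : 𝓢(SpaceTime d, ℂ)) (x : SpaceTime d) : reC h x = (h x).re := rfl

/-- Convolution of complex Schwartz functions, as a linear operator in the second factor. -/
def convC (f : 𝓢(SpaceTime d, ℂ)) : 𝓢(SpaceTime d, ℂ) →L[ℂ] 𝓢(SpaceTime d, ℂ) :=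
  SchwartzMap.convolution (ContinuousLinearMap.mul ℂ ℂ) f

/-- Convolution of real Schwartz functions, as a linear operator in the second factor. It is defined
through complex Schwartz functions, for which the Fourier transform is available. -/
def conv (ψ : Schw d) : Schw d →L[ℝ] Schw d :=
  reC.comp (((convC (toC ψ)).restrictScalars ℝ).comp toC)

theorem convC_apply (f g : 𝓢(SpaceTime d, ℂ)) (x : SpaceTime d) :
    convC f g x = ∫ y, f y * g (x - y) := by
  rw [convC, SchwartzMap.convolution_apply]
  rfl

theorem conv_eq (ψ χ : Schw d) : conv ψ χ = reC (convC (toC ψ) (toC χ)) := rfl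

theorem convC_toC_apply (ψ χ : Schw d) (x : SpaceTime d) :
    convC (toC ψ) (toC χ) x = ((∫ y, ψ y * χ (x - y) : ℝ) : ℂ) := by
  rw [convC_apply, ← integral_complex_ofReal]
  simp

theorem toC_conv (ψ χ : Schw d) : toC (conv ψ χ) = convC (toC ψ) (toC χ) := by
  ext x
  rw [toC_apply, conv_eq, reC_apply, convC_toC_apply, Complex.ofReal_re]

theorem conv_apply (ψ χ : Schw d) (x : SpaceTime d) :
    conv ψ χ x = ∫ y, ψ y * χ (x - y) := by
  rw [conv_eq, reC_apply, convC_toC_apply, Complex.ofReal_re]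

theorem conv_comm (ψ χ : Schw d) : conv ψ χ = conv χ ψ := by
  ext x
  rw [conv_apply, conv_apply, ← integral_sub_left_eq_self _ _ x]
  simp [mul_comm]

theorem fourier_convC (f g : 𝓢(SpaceTime d, ℂ)) (ξ : SpaceTime d) :
    𝓕 (convC f g) ξ = 𝓕 f ξ * 𝓕 g ξ := by
  rw [convC, SchwartzMap.fourier_convolution]
  rfl

theorem fourier_ext {f g : 𝓢(SpaceTime d, ℂ)} (h : ∀ ξ, 𝓕 f ξ = 𝓕 g ξ) : f = g := by
  have : 𝓕 f = 𝓕 g := SchwartzMap.ext h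
  have h2 : 𝓕⁻ (𝓕 f) = 𝓕⁻ (𝓕 g) := by rw [this]
  simpa using h2

theorem fourier_lineDerivOp_apply (f : 𝓢(SpaceTime d, ℂ)) (i : Fin (d + 1)) (ξ : SpaceTime d) :
    𝓕 (∂_{unitVec (d := d) i} f) ξ = (2 * Real.pi * Complex.I) * (ξ i : ℂ) * 𝓕 f ξ := by
  rw [SchwartzMap.fourier_lineDerivOp_eq]
  have h : (fun x : SpaceTime d => inner ℝ x (unitVec (d := d) i)).HasTemperateGrowth := by
    fun_prop
  have h2 : inner ℝ ξ (unitVec (d := d) i) = ξ i := by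
    simp [unitVec, EuclideanSpace.inner_single_right]
  rw [smul_apply, SchwartzMap.smulLeftCLM_apply_apply h, h2]
  simp [mul_assoc]

theorem lineDerivOp_convC (f g : 𝓢(SpaceTime d, ℂ)) (i : Fin (d + 1)) :
    ∂_{unitVec (d := d) i} (convC f g) = convC f (∂_{unitVec (d := d) i} g) := by
  refine fourier_ext fun ξ => ?_
  rw [fourier_lineDerivOp_apply, fourier_convC, fourier_convC, fourier_lineDerivOp_apply]
  ring

theorem partialD_reC (i : Fin (d + 1)) (h : 𝓢(SpaceTime d, ℂ)) :
    partialD i (reC h) = reC (∂_{unitVec (d := d) i} h) := by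
  ext x
  rw [partialD_apply, reC_apply, SchwartzMap.lineDerivOp_apply_eq_fderiv]
  have : (reC h : SpaceTime d → ℝ) = Complex.reCLM ∘ h := rfl
  rw [this, fderiv_comp x Complex.reCLM.differentiableAt h.differentiableAt]
  simp

theorem lineDerivOp_toC (i : Fin (d + 1)) (ψ : Schw d) :
    ∂_{unitVec (d := d) i} (toC ψ) = toC (partialD i ψ) := by
  ext x
  rw [toC_apply, partialD_apply, SchwartzMap.lineDerivOp_apply_eq_fderiv]
  have : (toC ψ : SpaceTime d → ℂ) = Complex.ofRealCLM ∘ ψ := rfl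
  rw [this, fderiv_comp x Complex.ofRealCLM.differentiableAt ψ.differentiableAt]
  simp

theorem partialD_conv (i : Fin (d + 1)) (ψ χ : Schw d) :
    partialD i (conv ψ χ) = conv ψ (partialD i χ) := by
  rw [conv_eq, partialD_reC, lineDerivOp_convC, lineDerivOp_toC, conv_eq]

theorem wordD_conv (s : List (Fin (d + 1))) (ψ χ : Schw d) :
    wordD s (conv ψ χ) = conv ψ (wordD s χ) := by
  induction s generalizing χ with
  | nil => rfl
  | cons i s ih => rw [wordD_cons, partialD_conv, ih, wordD_cons]

theorem conv_left_comm (ψ χ φ : Schw d) : conv ψ (conv χ φ) = conv χ (conv ψ φ) := by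
  rw [conv_eq ψ, conv_eq χ (conv ψ φ), toC_conv, toC_conv]
  congr 1
  refine fourier_ext fun ξ => ?_
  simp only [fourier_convC]
  ring

theorem rescale_conv (r : Scale) (ψ χ : Schw d) :
    rescale r (conv ψ χ) = conv (rescale r ψ) (rescale r χ) := by
  have hr : (r : ℝ) ^ (d + 2) ≠ 0 := (pow_pos r.2 _).ne'
  ext x
  rw [rescale_apply', conv_apply, conv_apply]
  have h := integral_comp_dilation_symm r fun y => ψ y * χ ((dilation d r).symm x - y)
  simp only [rescale_apply', map_sub]
  rw [smul_eq_mul] at h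
  simp only [mul_mul_mul_comm _ (ψ _) _ (χ _)]
  rw [integral_const_mul, h]
  field_simp


/-! ### The pointwise parabolic Taylor remainder -/

/-- The parabolic dilation with an arbitrary real factor; the Taylor expansion is at the factor
zero, which is not a length scale. -/
def dil (ε : ℝ) (y : SpaceTime d) : SpaceTime d := WithLp.toLp 2 fun i => ε ^ weight i * y i

/-- The monomial `y^s` attached to a word. -/
def wordPow (s : List (Fin (d + 1))) (y : SpaceTime d) : ℝ := (s.map fun i => y i).prod

/-- The coefficient with which the word `s` enters the parabolic Taylor expansion; the recursion is
the one produced by integrating `ε ^ (weight i - 1) * ε ^ order s`. -/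
def taylorCoeff : List (Fin (d + 1)) → ℝ
  | [] => 1
  | i :: s => -((weight i : ℝ) / (weight i + order s : ℕ)) * taylorCoeff s

/-- The finite set of all words of parabolic order less than `W`. -/
def words (d : ℕ) : ℕ → Finset (List (Fin (d + 1)))
  | 0 => ∅
  | W + 1 => insert [] (Finset.univ.biUnion fun i : Fin (d + 1) =>
      (words d (W + 1 - weight i)).image (List.cons i))
decreasing_by
  have := one_le_weight i
  omega

theorem words_zero : words d 0 = ∅ := by rw [words]

theorem order_lt_of_mem_words {W : ℕ} {s : List (Fin (d + 1))} (h : s ∈ words d W) :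
    order s < W := by
  induction s generalizing W with
  | nil =>
    cases W with
    | zero => simp [words_zero] at h
    | succ W => simp
  | cons i s ih =>
    cases W with
    | zero => simp [words_zero] at h
    | succ W =>
      rw [words] at h
      simp only [Finset.mem_insert, List.cons_ne_nil, Finset.mem_biUnion, Finset.mem_univ,
        Finset.mem_image, List.cons.injEq, true_and, false_or] at h
      obtain ⟨j, t, ht, rfl, rfl⟩ := h
      have := ih ht
      have := one_le_weight j
      rw [order_cons]
      omega

theorem mem_words {s : List (Fin (d + 1))} {W : ℕ} (h : order s < W) : s ∈ words d W := by
  induction s generalizing W with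
  | nil =>
    obtain ⟨W, rfl⟩ := Nat.exists_eq_succ_of_ne_zero (Nat.ne_of_gt h)
    rw [words]
    exact Finset.mem_insert_self _ _
  | cons i s ih =>
    obtain ⟨W, rfl⟩ := Nat.exists_eq_succ_of_ne_zero (Nat.ne_of_gt (Nat.zero_lt_of_lt h))
    rw [order_cons] at h
    rw [words]
    refine Finset.mem_insert_of_mem (Finset.mem_biUnion.2 ⟨i, Finset.mem_univ _, ?_⟩)
    exact Finset.mem_image.2 ⟨s, ih (by omega), rfl⟩

theorem sum_words_succ {M : Type*} [AddCommMonoid M] (W : ℕ) (g : List (Fin (d + 1)) → M) :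
    ∑ s ∈ words d (W + 1), g s
      = g [] + ∑ i : Fin (d + 1), ∑ s ∈ words d (W + 1 - weight i), g (i :: s) := by
  rw [words, Finset.sum_insert (by simp), Finset.sum_biUnion]
  · congr 1
    refine Finset.sum_congr rfl fun i _ => Finset.sum_image ?_
    intro a _ b _ h
    exact (List.cons.inj h).2
  · intro i _ j _ hij
    simp only [Function.onFun]
    rw [Finset.disjoint_left]
    intro s hs hs'
    simp only [Finset.mem_image] at hs hs'
    obtain ⟨a, -, rfl⟩ := hs
    obtain ⟨b, -, h⟩ := hs'
    exact hij (List.cons.inj h).1.symm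

theorem wordPow_cons (i : Fin (d + 1)) (s : List (Fin (d + 1))) (y : SpaceTime d) :
    wordPow (i :: s) y = y i * wordPow s y := by simp [wordPow]

/-- The pointwise remainder of the parabolic Taylor expansion of `ε ↦ χ (x - D_ε y)`. -/
def pointRem (W : ℕ) (χ : Schw d) (ε : ℝ) (x y : SpaceTime d) : ℝ :=
  χ (x - dil ε y)
    - ∑ s ∈ words d W, taylorCoeff s * ε ^ order s * wordPow s y * wordD s χ x

theorem hasDerivAt_dil (x y : SpaceTime d) (ε : ℝ) :
    HasDerivAt (fun ε => x - dil ε y)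
      (-∑ i : Fin (d + 1), (weight i * ε ^ (weight i - 1) * y i) • unitVec i) ε := by
  have h : ∀ ε, x - dil ε y = x - ∑ i : Fin (d + 1), (ε ^ weight i * y i) • unitVec (d := d) i := by
    intro ε
    ext j
    simp [dil, unitVec, Pi.single_apply]
  simp only [h]
  refine HasDerivAt.const_sub x (HasDerivAt.fun_sum fun i _ => ?_)
  exact ((hasDerivAt_pow _ _).mul_const _).smul_const _

/-- The derivative in `ε` of a remainder is a combination of remainders of lower order of the partial
derivatives of `χ`. This recursion is what the coefficients `taylorCoeff` are made for. -/
theorem hasDerivAt_pointRem (W : ℕ) (χ : Schw d) (x y : SpaceTime d) (ε : ℝ) :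
    HasDerivAt (fun ε => pointRem (W + 1) χ ε x y)
      (-∑ i : Fin (d + 1), weight i * ε ^ (weight i - 1) * y i *
        pointRem (W + 1 - weight i) (partialD i χ) ε x y) ε := by
  have h1 : HasDerivAt (fun ε => χ (x - dil ε y))
      (-∑ i : Fin (d + 1), weight i * ε ^ (weight i - 1) * y i * partialD i χ (x - dil ε y)) ε := by
    have h := (χ.differentiableAt (x := x - dil ε y)).hasFDerivAt.comp_hasDerivAt ε
      (hasDerivAt_dil x y ε)
    refine h.congr_deriv ?_
    simp [partialD_apply, map_sum]
  have h2 : HasDerivAt (fun ε : ℝ => ∑ s ∈ words d (W + 1),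
      taylorCoeff s * ε ^ order s * wordPow s y * wordD s χ x)
      (-∑ i : Fin (d + 1), ∑ s ∈ words d (W + 1 - weight i), weight i * ε ^ (weight i - 1) * y i *
        (taylorCoeff s * ε ^ order s * wordPow s y * wordD s (partialD i χ) x)) ε := by
    have hd : HasDerivAt (fun ε : ℝ => ∑ s ∈ words d (W + 1),
        taylorCoeff s * ε ^ order s * wordPow s y * wordD s χ x)
        (∑ s ∈ words d (W + 1),
          taylorCoeff s * (order s * ε ^ (order s - 1)) * wordPow s y * wordD s χ x) ε :=
      HasDerivAt.fun_sum fun s _ =>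
        (((hasDerivAt_pow _ _).const_mul _).mul_const _).mul_const _
    refine hd.congr_deriv ?_
    rw [sum_words_succ, ← Finset.sum_neg_distrib]
    simp only [order_nil, Nat.cast_zero, zero_mul, mul_zero, zero_add]
    refine Finset.sum_congr rfl fun i _ => ?_
    rw [← Finset.sum_neg_distrib]
    refine Finset.sum_congr rfl fun s _ => ?_
    have hw := one_le_weight i
    have hne : ((weight i + order s : ℕ) : ℝ) ≠ 0 := by
      have : 0 < weight i + order s := by omega
      exact_mod_cast this.ne'
    have hp : ε ^ (weight i + order s - 1) = ε ^ (weight i - 1) * ε ^ order s := by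
      rw [← pow_add]; congr 1; omega
    rw [order_cons, taylorCoeff, wordPow_cons, wordD_cons, hp]
    field_simp
  refine (h1.sub h2).congr_deriv ?_
  simp only [pointRem, mul_sub, Finset.sum_sub_distrib, Finset.mul_sum]
  ring

theorem pointRem_zero (W : ℕ) (χ : Schw d) (x y : SpaceTime d) :
    pointRem (W + 1) χ 0 x y = 0 := by
  have h0 : dil 0 y = 0 := by
    ext i
    have := one_le_weight i
    simp [dil, show weight i ≠ 0 by omega]
  rw [pointRem, sum_words_succ, h0]
  have : ∀ i : Fin (d + 1), ∀ s : List (Fin (d + 1)), (0 : ℝ) ^ order (i :: s) = 0 := by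
    intro i s
    have := one_le_weight i
    rw [order_cons, zero_pow (by omega)]
  simp only [this]
  simp [taylorCoeff, wordPow]

theorem norm_dil_le {ε : ℝ} (h0 : 0 ≤ ε) (h1 : ε ≤ 1) (y : SpaceTime d) : ‖dil ε y‖ ≤ ‖y‖ := by
  rw [EuclideanSpace.norm_eq, EuclideanSpace.norm_eq]
  refine Real.sqrt_le_sqrt (Finset.sum_le_sum fun i _ => ?_)
  have : ‖dil ε y i‖ ≤ ‖y i‖ := by
    simp only [dil, norm_mul, norm_pow]
    refine mul_le_of_le_one_left (norm_nonneg _) (pow_le_one₀ (norm_nonneg _) ?_)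
    rwa [Real.norm_of_nonneg h0]
  gcongr

theorem one_add_norm_le (x z : SpaceTime d) : 1 + ‖x‖ ≤ (1 + ‖x - z‖) * (1 + ‖z‖) := by
  have := norm_add_le (x - z) z
  rw [sub_add_cancel] at this
  nlinarith [norm_nonneg (x - z), norm_nonneg z, mul_nonneg (norm_nonneg (x - z)) (norm_nonneg z)]

/-- Bound on the parabolic Taylor remainder, uniform over bounded sets of Schwartz functions. The
proof is by strong induction on the order: the remainder vanishes at `ε = 0`, and its derivative is
controlled by the remainders of lower order. -/
theorem exists_pointRem_bound (W : ℕ) : ∀ {B : Set (Schw d)}, Bornology.IsVonNBounded ℝ B →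
    ∀ N : ℕ, ∃ C : ℝ, 0 ≤ C ∧ ∀ χ ∈ B, ∀ x y : SpaceTime d, ∀ ε : ℝ, 0 ≤ ε → ε ≤ 1 →
      (1 + ‖x‖) ^ N * |pointRem W χ ε x y| ≤ C * ε ^ W * (1 + ‖y‖) ^ (N + W) := by
  induction W using Nat.strong_induction_on with
  | _ W ih =>
  intro B hB N
  cases W with
  | zero =>
    obtain ⟨C, hC0, hC⟩ := exists_decay_of_isVonNBounded hB N
    refine ⟨C, hC0, fun χ hχ x y ε h0 h1 => ?_⟩
    have hx : 1 + ‖x‖ ≤ (1 + ‖x - dil ε y‖) * (1 + ‖y‖) :=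
      (one_add_norm_le x (dil ε y)).trans
        (by gcongr; exact norm_dil_le h0 h1 y)
    calc (1 + ‖x‖) ^ N * |pointRem 0 χ ε x y|
        ≤ ((1 + ‖x - dil ε y‖) * (1 + ‖y‖)) ^ N * |χ (x - dil ε y)| := by
          simp only [pointRem, words_zero, Finset.sum_empty, sub_zero]
          gcongr
      _ = ((1 + ‖x - dil ε y‖) ^ N * |χ (x - dil ε y)|) * (1 + ‖y‖) ^ N := by
          rw [mul_pow]; ring
      _ ≤ C * (1 + ‖y‖) ^ N := by
          gcongr; exact hC χ hχ _
      _ = _ := by simp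
  | succ W =>
    have hstep : ∀ i : Fin (d + 1), ∃ C : ℝ, 0 ≤ C ∧ ∀ χ ∈ B, ∀ x y : SpaceTime d, ∀ ε : ℝ,
        0 ≤ ε → ε ≤ 1 → (1 + ‖x‖) ^ N * |pointRem (W + 1 - weight i) (partialD i χ) ε x y|
          ≤ C * ε ^ (W + 1 - weight i) * (1 + ‖y‖) ^ (N + (W + 1 - weight i)) := by
      intro i
      have := one_le_weight i
      obtain ⟨C, h0, hC⟩ := ih (W + 1 - weight i) (by omega) (hB.image (partialD i)) N
      exact ⟨C, h0, fun χ hχ => hC _ (Set.mem_image_of_mem _ hχ)⟩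
    choose C hC0 hC using hstep
    refine ⟨∑ i : Fin (d + 1), weight i * C i,
      Finset.sum_nonneg fun i _ => mul_nonneg (Nat.cast_nonneg _) (hC0 i),
      fun χ hχ x y ε h0 h1 => ?_⟩
    set K : ℝ := ∑ i : Fin (d + 1), weight i * C i with hK
    have hbound : ∀ t ∈ Set.Ico 0 ε, ‖(1 + ‖x‖) ^ N * -∑ i : Fin (d + 1),
        weight i * t ^ (weight i - 1) * y i *
          pointRem (W + 1 - weight i) (partialD i χ) t x y‖
        ≤ K * ε ^ W * (1 + ‖y‖) ^ (N + (W + 1)) := by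
      rintro t ⟨ht0, htε⟩
      have ht1 : t ≤ 1 := htε.le.trans h1
      rw [norm_mul, norm_neg, Real.norm_of_nonneg (by positivity), hK, Finset.sum_mul,
        Finset.sum_mul]
      refine (mul_le_mul_of_nonneg_left (norm_sum_le _ _) (by positivity)).trans ?_
      rw [Finset.mul_sum]
      refine Finset.sum_le_sum fun i _ => ?_
      have hw := one_le_weight i
      have hyi : |y i| ≤ 1 + ‖y‖ := by
        have := PiLp.norm_apply_le y i
        rw [Real.norm_eq_abs] at this
        linarith
      have hpow : t ^ (weight i - 1) * t ^ (W + 1 - weight i) ≤ ε ^ W := by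
        rw [← pow_add]
        exact (pow_le_pow_of_le_one ht0 ht1 (by omega)).trans (pow_le_pow_left₀ ht0 htε.le _)
      have hy1 : (1 : ℝ) ≤ 1 + ‖y‖ := by linarith [norm_nonneg y]
      calc (1 + ‖x‖) ^ N * ‖weight i * t ^ (weight i - 1) * y i *
              pointRem (W + 1 - weight i) (partialD i χ) t x y‖
          = weight i * t ^ (weight i - 1) * |y i| *
              ((1 + ‖x‖) ^ N * |pointRem (W + 1 - weight i) (partialD i χ) t x y|) := by
            simp only [norm_mul, norm_pow, Real.norm_eq_abs, abs_of_nonneg ht0, Nat.abs_cast]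
            ring
        _ ≤ weight i * t ^ (weight i - 1) * (1 + ‖y‖) *
              (C i * t ^ (W + 1 - weight i) * (1 + ‖y‖) ^ (N + (W + 1 - weight i))) := by
            exact mul_le_mul (mul_le_mul_of_nonneg_left hyi (by positivity))
              (hC i χ hχ x y t ht0 ht1) (by positivity) (by positivity)
        _ = weight i * C i * (t ^ (weight i - 1) * t ^ (W + 1 - weight i)) *
              (1 + ‖y‖) ^ (N + (W + 1 - weight i) + 1) := by ring
        _ ≤ weight i * C i * ε ^ W * (1 + ‖y‖) ^ (N + (W + 1)) := by
            have := hC0 i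
            exact mul_le_mul (mul_le_mul_of_nonneg_left hpow (by positivity))
              (pow_le_pow_right₀ hy1 (by omega)) (by positivity) (by positivity)
    have hmv := norm_image_sub_le_of_norm_deriv_le_segment'
      (f := fun t => (1 + ‖x‖) ^ N * pointRem (W + 1) χ t x y) (a := 0) (b := ε)
      (fun t _ => ((hasDerivAt_pointRem W χ x y t).const_mul _).hasDerivWithinAt) hbound
      ε ⟨h0, le_rfl⟩
    simp only [pointRem_zero, mul_zero, sub_zero, norm_mul, Real.norm_eq_abs] at hmv
    rw [abs_of_nonneg (by positivity : (0 : ℝ) ≤ (1 + ‖x‖) ^ N)] at hmv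
    refine hmv.trans_eq ?_
    rw [pow_succ ε]
    ring

/-! ### Moments -/

theorem integrable_inv_bracket :
    Integrable fun x : SpaceTime d => ((1 + ‖x‖) ^ (d + 2))⁻¹ := by
  have h := integrable_one_add_norm (E := SpaceTime d) (μ := volume) (r := (d + 2 : ℕ))
    (by simp)
  refine h.congr (Filter.Eventually.of_forall fun x => ?_)
  simp only
  rw [Real.rpow_neg (by positivity), Real.rpow_natCast]

theorem integrable_of_bracket_bound {f : SpaceTime d → ℝ} (hf : AEStronglyMeasurable f) {C : ℝ}
    (h : ∀ x, (1 + ‖x‖) ^ (d + 2) * |f x| ≤ C) : Integrable f := by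
  refine (integrable_inv_bracket.const_mul C).mono' hf (Filter.Eventually.of_forall fun x => ?_)
  rw [Real.norm_eq_abs, ← div_eq_mul_inv, le_div_iff₀ (by positivity), mul_comm]
  exact h x

theorem abs_wordPow_le (s : List (Fin (d + 1))) (y : SpaceTime d) :
    |wordPow s y| ≤ (1 + ‖y‖) ^ s.length := by
  induction s with
  | nil => simp [wordPow]
  | cons i s ih =>
    have : |y i| ≤ 1 + ‖y‖ := by
      have := PiLp.norm_apply_le y i
      rw [Real.norm_eq_abs] at this
      linarith
    rw [wordPow_cons, abs_mul, List.length_cons, pow_succ, mul_comm]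
    gcongr

theorem continuous_wordPow (s : List (Fin (d + 1))) :
    Continuous (wordPow s : SpaceTime d → ℝ) := by
  induction s with
  | nil => exact continuous_const
  | cons i s ih =>
    have : (wordPow (i :: s) : SpaceTime d → ℝ) = fun y => y i * wordPow s y :=
      funext fun y => wordPow_cons i s y
    rw [this]
    fun_prop

theorem integrable_wordPow_mul (s : List (Fin (d + 1))) (ψ : Schw d) :
    Integrable fun y => wordPow s y * ψ y := by
  obtain ⟨C, -, hC⟩ := exists_decay ψ (d + 2 + s.length)
  refine integrable_of_bracket_bound (C := C)
    ((continuous_wordPow s).mul ψ.continuous).aestronglyMeasurable fun y => ?_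
  refine le_trans ?_ (hC y)
  rw [abs_mul, pow_add _ (d + 2), mul_assoc]
  refine mul_le_mul_of_nonneg_left ?_ (pow_nonneg (by positivity) _)
  exact mul_le_mul_of_nonneg_right (abs_wordPow_le s y) (abs_nonneg _)

/-- The moment `∫ y^s ψ(y) dy`. -/
def moment (s : List (Fin (d + 1))) (ψ : Schw d) : ℝ := ∫ y, wordPow s y * ψ y

theorem wordPow_dilation (s : List (Fin (d + 1))) (r : Scale) (y : SpaceTime d) :
    wordPow s (dilation d r y) = (r : ℝ) ^ order s * wordPow s y := by
  induction s with
  | nil => simp [wordPow]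
  | cons i s ih =>
    rw [wordPow_cons, wordPow_cons, ih, dilation_apply, order_cons, pow_add]
    ring

/-- Pairing with a rescaled function by parabolic change of variables. -/
theorem integral_rescale_mul (r : Scale) (ψ : Schw d) (f : SpaceTime d → ℝ) :
    ∫ z, rescale r ψ z * f z = ∫ y, ψ y * f (dilation d r y) := by
  have hr : (r : ℝ) ^ (d + 2) ≠ 0 := (pow_pos r.2 _).ne'
  have h := integral_comp_dilation_symm r fun y => ψ y * f (dilation d r y)
  simp only [ContinuousLinearEquiv.apply_symm_apply, smul_eq_mul] at h
  simp only [rescale_apply', mul_assoc]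
  rw [integral_const_mul, h, inv_mul_cancel_left₀ hr]

theorem moment_rescale (s : List (Fin (d + 1))) (r : Scale) (ψ : Schw d) :
    moment s (rescale r ψ) = (r : ℝ) ^ order s * moment s ψ := by
  have h := integral_rescale_mul r ψ (wordPow s)
  simp only [moment, mul_comm (wordPow s _)]
  rw [h, ← integral_const_mul]
  simp only [wordPow_dilation]
  congr 1
  ext y
  ring

/-! ### Convolution minus its Taylor expansion -/

/-- Convolution with `ψ`, minus its Taylor expansion: `conv ψ - ∑ γ_s (∫ y^s ψ) ∂_s`, the sum
running over all words of parabolic order less than `W`. -/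
def taylorRem (W : ℕ) (ψ : Schw d) : Schw d →L[ℝ] Schw d :=
  conv ψ - ∑ s ∈ words d W, (taylorCoeff s * moment s ψ) • wordD s

theorem taylorRem_eq (W : ℕ) (ψ χ : Schw d) :
    taylorRem W ψ χ
      = conv ψ χ - ∑ s ∈ words d W, (taylorCoeff s * moment s ψ) • wordD s χ := by
  simp [taylorRem]

theorem wordD_taylorRem (W : ℕ) (ψ χ : Schw d) (t : List (Fin (d + 1))) :
    wordD t (taylorRem W ψ χ) = taylorRem W ψ (wordD t χ) := by
  have comm : ∀ s : List (Fin (d + 1)), wordD t (wordD s χ) = wordD s (wordD t χ) := by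
    intro s
    induction s generalizing χ with
    | nil => rfl
    | cons i s ih => rw [wordD_cons, ih, wordD_partialD, ← wordD_cons]
  simp only [taylorRem_eq, map_sub, map_sum, map_smul, wordD_conv, comm]

theorem dil_eq_dilation (r : Scale) (y : SpaceTime d) : dil r y = dilation d r y := rfl

theorem rescale_taylorRem (W : ℕ) (r : Scale) (ψ χ : Schw d) :
    taylorRem W (rescale r ψ) (rescale r χ) = rescale r (taylorRem W ψ χ) := by
  have hr : ∀ n : ℕ, (r : ℝ) ^ n ≠ 0 := fun n => (pow_pos r.2 _).ne'
  rw [← rescaleL_apply r (taylorRem W ψ χ), taylorRem_eq, taylorRem_eq, map_sub, map_sum,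
    rescaleL_apply, rescale_conv]
  congr 1
  refine Finset.sum_congr rfl fun s _ => ?_
  rw [map_smul, moment_rescale, wordD_rescale, smul_smul, rescaleL_apply]
  congr 1
  field_simp [hr]

/-- The Taylor remainder of a convolution is the average of the pointwise Taylor remainders. -/
theorem taylorRem_rescale_apply (W : ℕ) (r : Scale) (ψ χ : Schw d) (x : SpaceTime d) :
    taylorRem W (rescale r ψ) χ x = ∫ y, ψ y * pointRem W χ r x y := by
  have h1 : Integrable fun y => ψ y * χ (x - dil r y) := by
    obtain ⟨C, -, hC⟩ := exists_decay ψ (d + 2)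
    obtain ⟨C', hC'0, hC'⟩ := exists_decay χ 0
    refine integrable_of_bracket_bound (C := C * C') ?_ fun y => ?_
    · have : Continuous fun y : SpaceTime d => dil (r : ℝ) y := (dilation d r).continuous
      exact (ψ.continuous.mul (χ.continuous.comp (by fun_prop))).aestronglyMeasurable
    · rw [abs_mul, ← mul_assoc]
      have := hC' (x - dil r y)
      rw [pow_zero, one_mul] at this
      exact mul_le_mul (hC y) this (abs_nonneg _) ((by positivity : (0 : ℝ) ≤ _).trans (hC y))
  have h2 : ∀ s ∈ words d W, Integrable fun y =>
      ψ y * (taylorCoeff s * (r : ℝ) ^ order s * wordPow s y * wordD s χ x) := by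
    intro s _
    refine ((integrable_wordPow_mul s ψ).const_mul
      (taylorCoeff s * (r : ℝ) ^ order s * wordD s χ x)).congr
        (Filter.Eventually.of_forall fun y => ?_)
    simp only
    ring
  simp only [pointRem, mul_sub, Finset.mul_sum]
  rw [integral_sub h1 (integrable_finsetSum _ h2), integral_finsetSum _ h2, taylorRem_eq]
  have h3 := integral_rescale_mul r ψ fun z => χ (x - z)
  simp only [sub_apply, sum_apply, smul_apply, conv_apply, h3, dil_eq_dilation, smul_eq_mul]
  congr 1
  refine Finset.sum_congr rfl fun s _ => ?_
  rw [moment_rescale, moment, ← integral_const_mul, ← integral_const_mul, ← integral_mul_const]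
  congr 1
  ext y
  ring

/-- The Taylor remainders at scale `ε ≤ 1` are of size `ε ^ W`, in the sense of bounded sets of
Schwartz functions and uniformly over bounded sets of both arguments. -/
theorem isVonNBounded_taylorRem (W : ℕ) {B₁ B₂ : Set (Schw d)}
    (h₁ : Bornology.IsVonNBounded ℝ B₁) (h₂ : Bornology.IsVonNBounded ℝ B₂) :
    Bornology.IsVonNBounded ℝ {φ : Schw d | ∃ ψ ∈ B₁, ∃ χ ∈ B₂, ∃ r : Scale, (r : ℝ) ≤ 1 ∧
      φ = ((r : ℝ) ^ W)⁻¹ • taylorRem W (rescale r ψ) χ} := by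
  rw [isVonNBounded_iff_wordD]
  intro s N
  obtain ⟨C, hC0, hC⟩ := exists_pointRem_bound W (h₂.image (wordD s)) N
  obtain ⟨C', hC'0, hC'⟩ := exists_decay_of_isVonNBounded h₁ (d + 2 + (N + W))
  refine ⟨C * C' * ∫ x : SpaceTime d, ((1 + ‖x‖) ^ (d + 2))⁻¹, ?_⟩
  rintro φ ⟨ψ, hψ, χ, hχ, r, hr, rfl⟩ x
  have hr0 : (0 : ℝ) < r := r.2
  rw [map_smul, wordD_taylorRem, smul_apply, taylorRem_rescale_apply, smul_eq_mul]
  have key : ∀ y, ‖((1 + ‖x‖) ^ N * ((r : ℝ) ^ W)⁻¹) * (ψ y * pointRem W (wordD s χ) r x y)‖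
      ≤ C * C' * ((1 + ‖y‖) ^ (d + 2))⁻¹ := by
    intro y
    have h := hC _ (Set.mem_image_of_mem _ hχ) x y r hr0.le hr
    have h' := hC' ψ hψ y
    rw [Real.norm_eq_abs, abs_mul, abs_mul, abs_mul,
      abs_of_nonneg (by positivity : (0 : ℝ) ≤ (1 + ‖x‖) ^ N),
      abs_of_nonneg (by positivity : (0 : ℝ) ≤ ((r : ℝ) ^ W)⁻¹)]
    calc (1 + ‖x‖) ^ N * ((r : ℝ) ^ W)⁻¹ * (|ψ y| * |pointRem W (wordD s χ) r x y|)
        = ((r : ℝ) ^ W)⁻¹ * |ψ y| * ((1 + ‖x‖) ^ N * |pointRem W (wordD s χ) r x y|) := by ring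
      _ ≤ ((r : ℝ) ^ W)⁻¹ * |ψ y| * (C * r ^ W * (1 + ‖y‖) ^ (N + W)) := by gcongr
      _ = C * ((1 + ‖y‖) ^ (d + 2 + (N + W)) * |ψ y|) * ((1 + ‖y‖) ^ (d + 2))⁻¹ := by
          rw [pow_add _ (d + 2)]
          field_simp
      _ ≤ C * C' * ((1 + ‖y‖) ^ (d + 2))⁻¹ := by gcongr
  rw [← abs_of_nonneg (by positivity : (0 : ℝ) ≤ (1 + ‖x‖) ^ N), ← abs_mul, ← mul_assoc,
    ← integral_const_mul, ← integral_const_mul, ← Real.norm_eq_abs]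
  exact norm_integral_le_of_norm_le (integrable_inv_bracket.const_mul _)
    (Filter.Eventually.of_forall key)

/-! ### The heat operator and reflection -/

/-- The heat operator `L = ∂₀ - ∑ ∂ᵢ²` on Schwartz functions. -/
def heat : Schw d →L[ℝ] Schw d :=
  partialD 0 - ∑ i : Fin d, (partialD i.succ).comp (partialD i.succ)

theorem heat_apply (φ : Schw d) :
    heat φ = partialD 0 φ - ∑ i : Fin d, partialD i.succ (partialD i.succ φ) := by
  simp [heat]

theorem heat_wordD (s : List (Fin (d + 1))) (φ : Schw d) :
    heat (wordD s φ) = wordD s (heat φ) := by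
  simp only [heat_apply, map_sub, map_sum, wordD_partialD]

theorem heat_conv (ψ φ : Schw d) : heat (conv ψ φ) = conv ψ (heat φ) := by
  simp only [heat_apply, map_sub, map_sum, partialD_conv]

theorem heat_taylorRem (W : ℕ) (ψ φ : Schw d) :
    heat (taylorRem W ψ φ) = taylorRem W ψ (heat φ) := by
  simp only [taylorRem_eq, map_sub, map_sum, map_smul, heat_conv, heat_wordD]

theorem heat_rescale (r : Scale) (φ : Schw d) :
    heat (rescale r φ) = ((r : ℝ) ^ 2)⁻¹ • rescale r (heat φ) := by
  have h1 : ∀ i : Fin d, weight i.succ = 1 := fun i => by simp [weight]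
  have h0 : weight (0 : Fin (d + 1)) = 2 := by simp [weight]
  simp only [heat_apply, partialD_rescale, map_smul, h1, h0, smul_smul]
  simp only [← rescaleL_apply, map_sub, map_sum, smul_sub, Finset.smul_sum, pow_one, pow_two,
    mul_inv]

/-- Reflection `φ ↦ φ(-·)`. -/
def refl : Schw d →L[ℝ] Schw d :=
  SchwartzMap.compCLMOfContinuousLinearEquiv ℝ (ContinuousLinearEquiv.neg ℝ)

theorem refl_apply (φ : Schw d) (x : SpaceTime d) : refl φ x = φ (-x) := rfl

theorem partialD_refl (i : Fin (d + 1)) (φ : Schw d) :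
    partialD i (refl φ) = -refl (partialD i φ) := by
  change ∂_{unitVec (d := d) i} (SchwartzMap.compCLMOfContinuousLinearEquiv ℝ
    (ContinuousLinearEquiv.neg ℝ) φ) = _
  rw [SchwartzMap.lineDerivOp_compCLMOfContinuousLinearEquiv]
  have : (ContinuousLinearEquiv.neg ℝ : SpaceTime d ≃L[ℝ] SpaceTime d) (unitVec i)
    = -unitVec (d := d) i := rfl
  rw [this, LineDeriv.lineDerivOp_left_neg, map_neg]
  rfl

theorem heatAdjoint_refl (φ : Schw d) : heatAdjoint (refl φ) = refl (heat φ) := by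
  have h : heatAdjoint (refl φ)
      = -partialD 0 (refl φ) - ∑ i : Fin d, partialD i.succ (partialD i.succ (refl φ)) := rfl
  rw [h, heat_apply]
  simp only [partialD_refl, map_neg, neg_neg, map_sub, map_sum]

/-! ### Schwartz functions annihilating polynomials -/

/-- Real parts of Schwartz functions whose Fourier transform vanishes near the origin. All their
moments vanish. -/
def Good (φ : Schw d) : Prop :=
  ∃ h : 𝓢(SpaceTime d, ℂ), φ = reC h ∧ ∀ᶠ ξ in 𝓝 0, 𝓕 h ξ = 0

theorem Good.add {φ φ' : Schw d} (h : Good φ) (h' : Good φ') : Good (φ + φ') := by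
  obtain ⟨g, rfl, hg⟩ := h
  obtain ⟨g', rfl, hg'⟩ := h'
  refine ⟨g + g', by rw [map_add], ?_⟩
  filter_upwards [hg, hg'] with ξ h1 h2
  rw [FourierTransform.fourier_add, add_apply, h1, h2, add_zero]

theorem Good.smul {φ : Schw d} (h : Good φ) (c : ℝ) : Good (c • φ) := by
  obtain ⟨g, rfl, hg⟩ := h
  refine ⟨(c : ℂ) • g, by ext x; simp, ?_⟩
  filter_upwards [hg] with ξ h1
  rw [FourierTransform.fourier_smul, smul_apply, h1, smul_zero]

theorem Good.zero : Good (0 : Schw d) :=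
  ⟨0, by rw [map_zero], Eventually.of_forall fun ξ => by
    rw [FourierTransform.fourier_zero]; rfl⟩

theorem Good.sum {ι : Type*} {s : Finset ι} {φ : ι → Schw d} (h : ∀ i ∈ s, Good (φ i)) :
    Good (∑ i ∈ s, φ i) :=
  Finset.sum_induction _ _ (fun _ _ => Good.add) Good.zero h

theorem Good.sub {φ φ' : Schw d} (h : Good φ) (h' : Good φ') : Good (φ - φ') := by
  have := h.add (h'.smul (-1))
  rwa [neg_one_smul, ← sub_eq_add_neg] at this

theorem Good.partialD {φ : Schw d} (h : Good φ) (i : Fin (d + 1)) :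
    Good (AbstractIntegration.partialD i φ) := by
  obtain ⟨g, rfl, hg⟩ := h
  refine ⟨_, partialD_reC i g, ?_⟩
  filter_upwards [hg] with ξ h1
  rw [fourier_lineDerivOp_apply, h1, mul_zero]

theorem Good.wordD {φ : Schw d} (h : Good φ) (s : List (Fin (d + 1))) :
    Good (AbstractIntegration.wordD s φ) := by
  induction s generalizing φ with
  | nil => exact h
  | cons i s ih => exact ih (h.partialD i)

theorem conv_reC (ψ : Schw d) (g : 𝓢(SpaceTime d, ℂ)) :
    conv ψ (reC g) = reC (convC (toC ψ) g) := by
  ext x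
  have hi : Integrable fun y => toC ψ y * g (x - y) := by
    refine ((toC ψ).integrable (μ := volume)).mul_bdd
      (c := SchwartzMap.seminorm ℝ 0 0 g) ?_ (Eventually.of_forall fun y =>
        SchwartzMap.norm_le_seminorm ℝ g _)
    exact (g.continuous.comp (by fun_prop)).aestronglyMeasurable
  rw [conv_apply, reC_apply, convC_apply]
  have := Complex.reCLM.integral_comp_comm hi
  rw [Complex.reCLM_apply] at this
  rw [← this]
  simp

theorem Good.conv {φ : Schw d} (h : Good φ) (ψ : Schw d) :
    Good (AbstractIntegration.conv ψ φ) := by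
  obtain ⟨g, rfl, hg⟩ := h
  refine ⟨_, conv_reC ψ g, ?_⟩
  filter_upwards [hg] with ξ h1
  rw [fourier_convC, h1, mul_zero]

theorem Good.taylorRem {φ : Schw d} (h : Good φ) (W : ℕ) (ψ : Schw d) :
    Good (AbstractIntegration.taylorRem W ψ φ) := by
  rw [taylorRem_eq]
  exact (h.conv ψ).sub (Good.sum fun s _ => (h.wordD s).smul _)

/-- Parabolic rescaling of complex Schwartz functions. -/
def rescaleC (r : Scale) : 𝓢(SpaceTime d, ℂ) →L[ℂ] 𝓢(SpaceTime d, ℂ) :=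
  (((r : ℝ) ^ (d + 2) : ℝ) : ℂ)⁻¹ •
    SchwartzMap.compCLMOfContinuousLinearEquiv ℂ (dilation d r).symm

theorem rescaleC_apply (r : Scale) (h : 𝓢(SpaceTime d, ℂ)) (x : SpaceTime d) :
    rescaleC r h x = (((r : ℝ) ^ (d + 2) : ℝ) : ℂ)⁻¹ * h ((dilation d r).symm x) := rfl

theorem reC_rescaleC (r : Scale) (h : 𝓢(SpaceTime d, ℂ)) :
    reC (rescaleC r h) = rescale r (reC h) := by
  ext x
  rw [reC_apply, rescaleC_apply, rescale_apply', reC_apply, ← Complex.ofReal_inv,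
    Complex.re_ofReal_mul]

theorem inner_dilation (r : Scale) (x ξ : SpaceTime d) :
    inner ℝ (dilation d r x) ξ = inner ℝ x (dilation d r ξ) := by
  simp only [PiLp.inner_apply, dilation_apply]
  refine Finset.sum_congr rfl fun i _ => ?_
  simp
  ring

theorem fourier_rescaleC (r : Scale) (h : 𝓢(SpaceTime d, ℂ)) (ξ : SpaceTime d) :
    𝓕 (rescaleC r h) ξ = 𝓕 h (dilation d r ξ) := by
  have hr : (((r : ℝ) ^ (d + 2) : ℝ) : ℂ) ≠ 0 :=
    Complex.ofReal_ne_zero.2 (pow_pos r.2 _).ne'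
  rw [SchwartzMap.fourier_coe, SchwartzMap.fourier_coe, Real.fourier_eq', Real.fourier_eq']
  have h1 := integral_comp_dilation_symm r fun y : SpaceTime d =>
    Complex.exp (((-2 * Real.pi * inner ℝ (dilation d r y) ξ : ℝ) : ℂ) * Complex.I) • h y
  simp only [ContinuousLinearEquiv.apply_symm_apply] at h1
  simp only [rescaleC_apply, smul_eq_mul, mul_left_comm _ (_ : ℂ)⁻¹] at h1 ⊢
  rw [integral_const_mul, h1, Complex.real_smul, inv_mul_cancel_left₀ hr]
  simp only [inner_dilation]

theorem Good.rescale {φ : Schw d} (h : Good φ) (r : Scale) :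
    Good (AbstractIntegration.rescale r φ) := by
  obtain ⟨g, rfl, hg⟩ := h
  refine ⟨_, (reC_rescaleC r g).symm, ?_⟩
  have ht : Tendsto (dilation d r) (𝓝 0) (𝓝 0) := by
    have := (dilation d r).continuous.tendsto 0
    rwa [map_zero] at this
  filter_upwards [ht.eventually hg] with ξ h1
  rw [fourier_rescaleC, h1]

/-- Multiplication by the `i`-th coordinate. -/
def mulX (i : Fin (d + 1)) (h : 𝓢(SpaceTime d, ℂ)) : 𝓢(SpaceTime d, ℂ) :=
  SchwartzMap.smulLeftCLM ℂ (fun x : SpaceTime d => inner ℝ x (unitVec (d := d) i)) h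

theorem mulX_apply (i : Fin (d + 1)) (h : 𝓢(SpaceTime d, ℂ)) (x : SpaceTime d) :
    mulX i h x = (x i : ℂ) * h x := by
  have h1 : (fun x : SpaceTime d => inner ℝ x (unitVec (d := d) i)).HasTemperateGrowth := by
    fun_prop
  have h2 : inner ℝ x (unitVec (d := d) i) = x i := by
    simp [unitVec, EuclideanSpace.inner_single_right]
  rw [mulX, SchwartzMap.smulLeftCLM_apply_apply h1, h2, Complex.real_smul]

/-- If the Fourier transform of `h` is constant near the origin, that of `x_i h` vanishes there. -/
theorem fourier_mulX_eventually {h : 𝓢(SpaceTime d, ℂ)} {c : ℂ} (i : Fin (d + 1))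
    (hc : ∀ᶠ ξ in 𝓝 0, 𝓕 h ξ = c) : ∀ᶠ ξ in 𝓝 0, 𝓕 (mulX i h) ξ = 0 := by
  have h1 := SchwartzMap.lineDerivOp_fourier_eq h (unitVec (d := d) i)
  rw [FourierTransform.fourier_smul] at h1
  have h2 : ∀ᶠ ξ in 𝓝 0, fderiv ℝ (𝓕 h : 𝓢(SpaceTime d, ℂ)) ξ = 0 := by
    have h3 : (𝓕 h : 𝓢(SpaceTime d, ℂ)) =ᶠ[𝓝 0] fun _ => c := hc
    filter_upwards [h3.fderiv (𝕜 := ℝ)] with ξ hξ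
    rw [hξ]
    simp
  filter_upwards [h2] with ξ hξ
  have h4 := congrArg (fun g : 𝓢(SpaceTime d, ℂ) => g ξ) h1
  simp only [SchwartzMap.lineDerivOp_apply_eq_fderiv, hξ, smul_apply, zero_apply] at h4
  have h5 : -(2 * (Real.pi : ℂ) * Complex.I) ≠ 0 := by
    simp [Real.pi_ne_zero]
  exact (smul_eq_zero.1 h4.symm).resolve_left h5

theorem integral_eq_fourier_zero (h : 𝓢(SpaceTime d, ℂ)) : ∫ x, h x = 𝓕 h 0 := by
  rw [SchwartzMap.fourier_coe, Real.fourier_eq']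
  simp

theorem integral_reC (h : 𝓢(SpaceTime d, ℂ)) : ∫ x, reC h x = (𝓕 h 0).re := by
  rw [← integral_eq_fourier_zero]
  exact Complex.reCLM.integral_comp_comm (h.integrable (μ := volume))

/-- Multiplication by a polynomial turns into differentiation of the Fourier transform, which keeps it
zero near the origin; in particular the integral of the product vanishes. -/
theorem Good.integral_eval_mul {φ : Schw d} (hφ : Good φ) (p : MvPolynomial (Fin (d + 1)) ℝ) :
    ∫ x : SpaceTime d, MvPolynomial.eval (fun i => x i) p * φ x = 0 := by
  obtain ⟨h, rfl, hh⟩ := hφ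
  have key : ∃ g : 𝓢(SpaceTime d, ℂ),
      (∀ x, g x = ((MvPolynomial.eval (fun i => x i) p : ℝ) : ℂ) * h x) ∧
        ∀ᶠ ξ in 𝓝 0, 𝓕 g ξ = 0 := by
    induction p using MvPolynomial.induction_on with
    | C a =>
      refine ⟨(a : ℂ) • h, fun x => by simp, ?_⟩
      filter_upwards [hh] with ξ h1
      rw [FourierTransform.fourier_smul, smul_apply, h1, smul_zero]
    | add p q hp hq =>
      obtain ⟨g, hg, hg'⟩ := hp
      obtain ⟨k, hk, hk'⟩ := hq
      refine ⟨g + k, fun x => by simp [hg, hk, add_mul], ?_⟩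
      filter_upwards [hg', hk'] with ξ h1 h2
      rw [FourierTransform.fourier_add, add_apply, h1, h2, add_zero]
    | mul_X p i hp =>
      obtain ⟨g, hg, hg'⟩ := hp
      refine ⟨mulX i g, fun x => ?_, fourier_mulX_eventually i hg'⟩
      rw [mulX_apply, hg]
      simp
      ring
  obtain ⟨g, hg, hg'⟩ := key
  have h1 : ∀ x : SpaceTime d, MvPolynomial.eval (fun i => x i) p * reC h x = reC g x := by
    intro x
    rw [reC_apply, reC_apply, hg, Complex.re_ofReal_mul]
  simp only [h1]
  rw [integral_reC, hg'.self_of_nhds, Complex.zero_re]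

theorem convZero_eq (F : Distr d) (φ : Schw d) : convZero F φ = F (refl φ) := rfl

/-- A good function does not see the polynomial in the equation `L u = f` modulo polynomials. -/
theorem SolvesModPoly.convZero_heat {m : ℝ} {u f : Distr d} (h : SolvesModPoly m u f)
    {φ : Schw d} (hφ : Good φ) : convZero u (heat φ) = convZero f φ := by
  obtain ⟨p, -, hp⟩ := h
  have h1 := hp (refl φ)
  rw [heatAdjoint_refl] at h1
  rw [convZero_eq, convZero_eq, h1, add_eq_left, ← integral_neg_eq_self]
  have h2 := hφ.integral_eval_mul (MvPolynomial.bind₁ (fun i => -MvPolynomial.X i) p)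
  rw [← h2]
  congr 1
  ext x
  rw [refl_apply, neg_neg]
  congr 1
  simp only [MvPolynomial.eval, MvPolynomial.eval₂Hom_bind₁]
  simp

/-! ### The kernel and its potential -/

/-- The dyadic length scale `2 ^ k`. -/
def dyadic (k : ℤ) : Scale := ⟨(2 : ℝ) ^ k, Set.mem_Ioi.2 (zpow_pos two_pos k)⟩

@[simp] theorem coe_dyadic (k : ℤ) : (dyadic k : ℝ) = (2 : ℝ) ^ k := rfl

theorem rescale_dyadic_dyadic (k l : ℤ) (ψ : Schw d) :
    rescale (dyadic k) (rescale (dyadic l) ψ) = rescale (dyadic (k + l)) ψ :=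
  rescale_rescale (by simp [zpow_add₀]) ψ

/-- The Fourier symbol of the heat operator. -/
def heatSymbol (ξ : SpaceTime d) : ℂ :=
  2 * Real.pi * Complex.I * (ξ 0 : ℂ) + 4 * (Real.pi : ℂ) ^ 2 * ∑ i : Fin d, (ξ i.succ : ℂ) ^ 2

theorem heatSymbol_ne_zero {ξ : SpaceTime d} (h : ξ ≠ 0) : heatSymbol ξ ≠ 0 := by
  contrapose! h
  have e : heatSymbol ξ = ((4 * Real.pi ^ 2 * ∑ i : Fin d, (ξ i.succ) ^ 2 : ℝ) : ℂ)
      + ((2 * Real.pi * ξ 0 : ℝ) : ℂ) * Complex.I := by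
    simp only [heatSymbol]
    push_cast
    ring
  rw [e] at h
  have hre := congrArg Complex.re h
  have him := congrArg Complex.im h
  simp only [Complex.add_re, Complex.ofReal_re, Complex.re_ofReal_mul, Complex.I_re, mul_zero,
    add_zero, Complex.zero_re] at hre
  simp only [Complex.add_im, Complex.ofReal_im, Complex.im_ofReal_mul, Complex.I_im, mul_one,
    zero_add, Complex.zero_im] at him
  have hpi := Real.pi_ne_zero
  have h0 : ξ 0 = 0 := by simpa [hpi] using him
  have h1 : ∑ i : Fin d, (ξ i.succ) ^ 2 = 0 := by simpa [hpi] using hre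
  rw [Finset.sum_eq_zero_iff_of_nonneg fun i _ => sq_nonneg _] at h1
  ext i
  refine Fin.cases h0 (fun i => ?_) i
  simpa using h1 i (Finset.mem_univ i)

theorem contDiff_heatSymbol : ContDiff ℝ (⊤ : ℕ∞) (heatSymbol : SpaceTime d → ℂ) := by
  have h : ∀ i : Fin (d + 1), ContDiff ℝ (⊤ : ℕ∞) fun ξ : SpaceTime d => (ξ i : ℂ) := fun i =>
    Complex.ofRealCLM.contDiff.comp (EuclideanSpace.proj (𝕜 := ℝ) i).contDiff
  exact (contDiff_const.mul (h 0)).add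
    (contDiff_const.mul (ContDiff.sum fun i _ => (h i.succ).pow 2))

theorem fourier_sub_apply (f g : 𝓢(SpaceTime d, ℂ)) (ξ : SpaceTime d) :
    𝓕 (f - g) ξ = 𝓕 f ξ - 𝓕 g ξ := by
  have h := map_sub (fourierCLM ℂ 𝓢(SpaceTime d, ℂ)) f g
  exact congrArg (fun k : 𝓢(SpaceTime d, ℂ) => k ξ) h

theorem fourier_heat (h : 𝓢(SpaceTime d, ℂ)) (ξ : SpaceTime d) :
    𝓕 (∂_{unitVec (d := d) 0} h
      - ∑ i : Fin d, ∂_{unitVec (d := d) i.succ} (∂_{unitVec (d := d) i.succ} h)) ξ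
      = heatSymbol ξ * 𝓕 h ξ := by
  rw [fourier_sub_apply, FourierTransform.fourier_sum, sum_apply]
  simp only [fourier_lineDerivOp_apply, heatSymbol, add_mul, Finset.mul_sum, Finset.sum_mul]
  rw [sub_eq_add_neg, ← Finset.sum_neg_distrib]
  congr 1
  refine Finset.sum_congr rfl fun i _ => ?_
  linear_combination (-4 * (Real.pi : ℂ) ^ 2 * (ξ i.succ : ℂ) ^ 2 * 𝓕 h ξ) * Complex.I_sq

/-- A smooth cut-off function, equal to one near the origin. -/
def cutoff : ContDiffBump (0 : SpaceTime d) := ⟨1, 2, by norm_num, by norm_num⟩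

/-- The cut-off function as a complex Schwartz function. -/
def cutoffS : 𝓢(SpaceTime d, ℂ) :=
  HasCompactSupport.toSchwartzMap (f := fun ξ : SpaceTime d => ((cutoff ξ : ℝ) : ℂ))
    ((cutoff (d := d)).hasCompactSupport.comp_left (g := ((↑) : ℝ → ℂ)) Complex.ofReal_zero)
    (Complex.ofRealCLM.contDiff.comp (cutoff (d := d)).contDiff)

theorem cutoffS_eventually : ∀ᶠ ξ : SpaceTime d in 𝓝 0, cutoffS ξ = 1 := by
  filter_upwards [(cutoff (d := d)).eventuallyEq_one] with ξ hξ
  change ((cutoff ξ : ℝ) : ℂ) = 1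
  rw [hξ]
  simp

/-- The dyadic difference of cut-off functions. -/
def cutoffDiff (ξ : SpaceTime d) : ℂ := cutoffS ξ - cutoffS (dilation d (dyadic 1) ξ)

theorem cutoffDiff_eventually : ∀ᶠ ξ : SpaceTime d in 𝓝 0, cutoffDiff ξ = 0 := by
  have ht : Tendsto (dilation d (dyadic 1)) (𝓝 0) (𝓝 0) := by
    have := (dilation d (dyadic 1)).continuous.tendsto 0
    rwa [map_zero] at this
  filter_upwards [cutoffS_eventually, ht.eventually cutoffS_eventually] with ξ h1 h2
  rw [cutoffDiff, h1, h2, sub_self]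

theorem contDiff_cutoffDiff : ContDiff ℝ (⊤ : ℕ∞) (cutoffDiff : SpaceTime d → ℂ) :=
  (cutoffS.smooth _).sub ((cutoffS.smooth _).comp (dilation d (dyadic 1)).contDiff)

/-- The quotient of the dyadic difference of cut-offs by the symbol of the heat operator. -/
def quotS : 𝓢(SpaceTime d, ℂ) :=
  HasCompactSupport.toSchwartzMap (f := fun ξ : SpaceTime d => cutoffDiff ξ / heatSymbol ξ)
    (by
      have h1 : HasCompactSupport (cutoffS : SpaceTime d → ℂ) :=
        (cutoff (d := d)).hasCompactSupport.comp_left (g := ((↑) : ℝ → ℂ)) Complex.ofReal_zero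
      have h2 : HasCompactSupport fun ξ : SpaceTime d => cutoffS (dilation d (dyadic 1) ξ) :=
        h1.comp_homeomorph (dilation d (dyadic 1)).toHomeomorph
      have h3 : HasCompactSupport (cutoffDiff : SpaceTime d → ℂ) := h1.sub h2
      simp only [div_eq_mul_inv]
      exact h3.mul_right)
    (by
      rw [contDiff_iff_contDiffAt]
      intro ξ
      by_cases h : ξ = 0
      · subst h
        refine (contDiffAt_const (c := (0 : ℂ))).congr_of_eventuallyEq ?_
        filter_upwards [cutoffDiff_eventually] with ξ hξ
        rw [hξ, zero_div]
      · simp only [div_eq_mul_inv]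
        exact contDiff_cutoffDiff.contDiffAt.mul
          (contDiff_heatSymbol.contDiffAt.inv (heatSymbol_ne_zero h)))

/-- The smoothing kernel: its Fourier transform equals one near the origin. -/
def kernel (d : ℕ) : Schw d := reC (𝓕⁻ cutoffS)

/-- The potential: its image under the heat operator is a dyadic difference of the kernel. -/
def potential (d : ℕ) : Schw d := reC (𝓕⁻ quotS)

theorem good_potential : Good (potential d) := by
  refine ⟨_, rfl, ?_⟩
  filter_upwards [cutoffDiff_eventually] with ξ hξ
  rw [FourierTransform.fourier_fourierInv_eq]
  change cutoffDiff ξ / heatSymbol ξ = 0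
  rw [hξ, zero_div]

theorem heat_reC (h : 𝓢(SpaceTime d, ℂ)) :
    heat (reC h) = reC (∂_{unitVec (d := d) 0} h
      - ∑ i : Fin d, ∂_{unitVec (d := d) i.succ} (∂_{unitVec (d := d) i.succ} h)) := by
  simp only [heat_apply, partialD_reC, map_sub, map_sum]

theorem heat_potential :
    heat (potential d) = kernel d - rescale (dyadic 1) (kernel d) := by
  rw [potential, heat_reC, kernel, ← reC_rescaleC, ← map_sub]
  congr 1
  refine fourier_ext fun ξ => ?_
  rw [fourier_heat, fourier_sub_apply, fourier_rescaleC,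
    FourierTransform.fourier_fourierInv_eq, FourierTransform.fourier_fourierInv_eq]
  change heatSymbol ξ * (cutoffDiff ξ / heatSymbol ξ) = cutoffDiff ξ
  by_cases h : ξ = 0
  · subst h
    rw [cutoffDiff_eventually.self_of_nhds]
    simp
  · rw [mul_div_cancel₀]
    exact heatSymbol_ne_zero h

/-- All derivatives of the Fourier transform of the kernel vanish at the origin, since it is constant
near the origin. -/
theorem moment_kernel_of_ne_nil {s : List (Fin (d + 1))} (hs : s ≠ []) :
    moment s (kernel d) = 0 := by
  have key : ∀ s : List (Fin (d + 1)), ∃ (g : 𝓢(SpaceTime d, ℂ)) (c : ℂ),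
      (∀ x, g x = (wordPow s x : ℂ) * 𝓕⁻ cutoffS x) ∧ (s ≠ [] → c = 0) ∧
        ∀ᶠ ξ in 𝓝 0, 𝓕 g ξ = c := by
    intro s
    induction s with
    | nil =>
      refine ⟨𝓕⁻ cutoffS, 1, fun x => by simp [wordPow], fun h => absurd rfl h, ?_⟩
      rw [FourierTransform.fourier_fourierInv_eq]
      exact cutoffS_eventually
    | cons i s ih =>
      obtain ⟨g, c, hg, -, hc⟩ := ih
      refine ⟨mulX i g, 0, fun x => ?_, fun _ => rfl, fourier_mulX_eventually i hc⟩
      rw [mulX_apply, hg, wordPow_cons]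
      push_cast
      ring
  obtain ⟨g, c, hg, hc, hgc⟩ := key s
  have h1 : ∀ x, wordPow s x * kernel d x = reC g x := by
    intro x
    rw [kernel, reC_apply, reC_apply, hg, Complex.re_ofReal_mul]
  simp only [moment, h1]
  rw [integral_reC, hgc.self_of_nhds, hc hs, Complex.zero_re]

theorem moment_kernel_nil : moment [] (kernel d) = 1 := by
  simp only [moment, wordPow, List.map_nil, List.prod_nil, one_mul]
  rw [kernel, integral_reC, FourierTransform.fourier_fourierInv_eq,
    cutoffS_eventually.self_of_nhds, Complex.one_re]

/-- The Taylor remainder of convolution with the rescaled kernel is its distance to the identity. -/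
theorem taylorRem_kernel {W : ℕ} (hW : W ≠ 0) (r : Scale) (φ : Schw d) :
    taylorRem W (rescale r (kernel d)) φ = conv (rescale r (kernel d)) φ - φ := by
  obtain ⟨W, rfl⟩ := Nat.exists_eq_succ_of_ne_zero hW
  rw [taylorRem_eq, sum_words_succ]
  congr 1
  simp only [moment_rescale, moment_kernel_of_ne_nil (List.cons_ne_nil _ _), moment_kernel_nil]
  simp [taylorCoeff]

/-! ### Exchanging distributions and convolution integrals -/

/-- A functional that is bounded on bounded sets of Schwartz functions has finite order: it is
controlled by finitely many weighted derivatives. Otherwise one could pick a sequence of functions,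
eventually in the unit ball of each seminorm, on which the functional is unbounded. -/
theorem exists_finite_order (p : Schw d → ℝ≥0∞)
    (hp : ∀ B : Set (Schw d), Bornology.IsVonNBounded ℝ B → ∃ C : ℝ, ∀ φ ∈ B,
      p φ ≤ ENNReal.ofReal C) :
    ∃ n : ℕ, ∀ φ : Schw d, (∀ s ∈ words d n, ∀ x, (1 + ‖x‖) ^ n * |wordD s φ x| ≤ 1) →
      p φ ≤ n := by
  by_contra! h
  choose φ hφ hp' using h
  have hB : Bornology.IsVonNBounded ℝ (Set.range φ) := by
    rw [isVonNBounded_iff_wordD]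
    intro s N
    have h1 : ∀ n, ∃ C : ℝ, 0 ≤ C ∧ ∀ x, (1 + ‖x‖) ^ N * |wordD s (φ n) x| ≤ C :=
      fun n => exists_decay _ _
    choose C hC0 hC using h1
    set M := max N (order s + 1)
    refine ⟨1 + ∑ n ∈ Finset.range M, C n, ?_⟩
    rintro _ ⟨n, rfl⟩ x
    have hS : 0 ≤ ∑ n ∈ Finset.range M, C n := Finset.sum_nonneg fun n _ => hC0 n
    by_cases hn : n < M
    · have := Finset.single_le_sum (fun n _ => hC0 n) (Finset.mem_range.2 hn)
      linarith [hC n x]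
    · have hNn : N ≤ n := (le_max_left _ _).trans (not_lt.1 hn)
      have hsn : order s + 1 ≤ n := (le_max_right _ _).trans (not_lt.1 hn)
      have h2 := hφ n s (mem_words hsn) x
      have h3 : (1 + ‖x‖) ^ N ≤ (1 + ‖x‖) ^ n :=
        pow_le_pow_right₀ (by linarith [norm_nonneg x]) hNn
      have := mul_le_mul_of_nonneg_right h3 (abs_nonneg (wordD s (φ n) x))
      linarith
  obtain ⟨C, hC⟩ := hp _ hB
  obtain ⟨n, hn⟩ := exists_nat_gt C
  have h1 := (hp' n).trans_le (hC _ ⟨n, rfl⟩)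
  rw [← ENNReal.ofReal_natCast] at h1
  exact absurd (ENNReal.ofReal_lt_ofReal_iff'.1 h1).1 (not_lt.2 hn.le)

/-- Translation `φ ↦ φ(· - y)`. -/
def trans (y : SpaceTime d) : Schw d →L[ℝ] Schw d := SchwartzMap.compSubConstCLM ℝ y

theorem trans_apply (y : SpaceTime d) (φ : Schw d) (x : SpaceTime d) :
    trans y φ x = φ (x - y) := rfl

theorem wordD_trans (s : List (Fin (d + 1))) (y : SpaceTime d) (φ : Schw d) :
    wordD s (trans y φ) = trans y (wordD s φ) := by
  induction s generalizing φ with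
  | nil => rfl
  | cons i s ih =>
    have h : partialD i (trans y φ) = trans y (partialD i φ) := by
      ext x
      rw [trans_apply, partialD_apply, partialD_apply, ← fderiv_comp_sub]
      rfl
    rw [wordD_cons, h, ih, wordD_cons]

theorem exists_decay_trans (φ : Schw d) (N : ℕ) :
    ∃ C : ℝ, 0 ≤ C ∧ ∀ x y, (1 + ‖x‖) ^ N * |φ (x - y)| ≤ C * (1 + ‖y‖) ^ N := by
  obtain ⟨C, h0, hC⟩ := exists_decay φ N
  refine ⟨C, h0, fun x y => ?_⟩
  calc (1 + ‖x‖) ^ N * |φ (x - y)|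
      ≤ ((1 + ‖x - y‖) * (1 + ‖y‖)) ^ N * |φ (x - y)| := by
        gcongr
        exact one_add_norm_le x y
    _ = ((1 + ‖x - y‖) ^ N * |φ (x - y)|) * (1 + ‖y‖) ^ N := by rw [mul_pow]; ring
    _ ≤ _ := by gcongr; exact hC _

/-- Translation is locally Lipschitz continuous in weighted supremum norms. -/
theorem exists_trans_sub_le (φ : Schw d) (N : ℕ) :
    ∃ C : ℝ, 0 ≤ C ∧ ∀ x y y', ‖y - y'‖ ≤ 1 →
      (1 + ‖x‖) ^ N * |φ (x - y) - φ (x - y')| ≤ C * (2 + ‖y'‖) ^ N * ‖y - y'‖ := by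
  set C : ℝ := 2 ^ N * (Finset.Iic (N, 1)).sup (fun m => SchwartzMap.seminorm ℝ m.1 m.2) φ with hCdef
  have hC : ∀ z, (1 + ‖z‖) ^ N * ‖fderiv ℝ φ z‖ ≤ C := by
    intro z
    have := SchwartzMap.one_add_le_sup_seminorm_apply (𝕜 := ℝ) (m := (N, 1)) (k := N) (n := 1)
      le_rfl le_rfl φ z
    rwa [norm_iteratedFDeriv_one] at this
  have hC0 : 0 ≤ C := le_trans (by positivity) (hC 0)
  refine ⟨C, hC0, fun x y y' hy => ?_⟩
  have hseg : ∀ z ∈ segment ℝ (x - y') (x - y),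
      ‖fderiv ℝ φ z‖ ≤ C * (2 + ‖y'‖) ^ N / (1 + ‖x‖) ^ N := by
    intro z hz
    have hxz : ‖x - z‖ ≤ 1 + ‖y'‖ := by
      have h1 : z ∈ Metric.closedBall (x - y') 1 := by
        refine (convex_closedBall _ _).segment_subset (Metric.mem_closedBall_self zero_le_one) ?_ hz
        rw [mem_closedBall_iff_norm]
        have : x - y - (x - y') = -(y - y') := by abel
        rwa [this, norm_neg]
      rw [mem_closedBall_iff_norm] at h1
      have h2 : x - z = y' - (z - (x - y')) := by abel
      rw [h2]
      linarith [norm_sub_le y' (z - (x - y'))]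
    rw [le_div_iff₀ (by positivity)]
    calc ‖fderiv ℝ φ z‖ * (1 + ‖x‖) ^ N
        ≤ ‖fderiv ℝ φ z‖ * ((1 + ‖z‖) * (2 + ‖y'‖)) ^ N := by
          gcongr
          have h3 := one_add_norm_le x (x - z)
          rw [sub_sub_cancel] at h3
          exact h3.trans (mul_le_mul_of_nonneg_left (by linarith) (by positivity))
      _ = ((1 + ‖z‖) ^ N * ‖fderiv ℝ φ z‖) * (2 + ‖y'‖) ^ N := by rw [mul_pow]; ring
      _ ≤ _ := by gcongr; exact hC z
  have hmv := (convex_segment (x - y') (x - y)).norm_image_sub_le_of_norm_fderiv_le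
    (f := φ) (𝕜 := ℝ) (fun z _ => φ.differentiableAt) hseg
    (left_mem_segment ℝ _ _) (right_mem_segment ℝ _ _)
  have h4 : ‖x - y - (x - y')‖ = ‖y - y'‖ := by
    have : x - y - (x - y') = -(y - y') := by abel
    rw [this, norm_neg]
  rw [h4, Real.norm_eq_abs] at hmv
  calc (1 + ‖x‖) ^ N * |φ (x - y) - φ (x - y')|
      ≤ (1 + ‖x‖) ^ N * (C * (2 + ‖y'‖) ^ N / (1 + ‖x‖) ^ N * ‖y - y'‖) := by gcongr
    _ = _ := by field_simp

/-- Finitely many weighted derivatives, as a continuous linear map into a Banach space. -/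
def jet (n : ℕ) : Schw d →L[ℝ] (words d n → (SpaceTime d →ᵇ ℝ)) :=
  ContinuousLinearMap.pi fun s =>
    (SchwartzMap.toBoundedContinuousFunctionCLM ℝ (SpaceTime d) ℝ).comp
      ((SchwartzMap.smulLeftCLM ℝ fun x : SpaceTime d => (1 + ‖x‖ ^ 2) ^ n).comp (wordD s.1))

theorem jet_apply (n : ℕ) (φ : Schw d) (s : words d n) (x : SpaceTime d) :
    jet n φ s x = (1 + ‖x‖ ^ 2) ^ n * wordD s.1 φ x := by
  have h : (fun x : SpaceTime d => (1 + ‖x‖ ^ 2) ^ n).HasTemperateGrowth := by fun_prop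
  exact SchwartzMap.smulLeftCLM_apply_apply h (wordD s.1 φ) x

theorem one_add_sq_le (x : SpaceTime d) (n : ℕ) : (1 + ‖x‖ ^ 2) ^ n ≤ (1 + ‖x‖) ^ (2 * n) := by
  rw [pow_mul]
  gcongr
  nlinarith [norm_nonneg x]

theorem one_add_le_sq (x : SpaceTime d) (n : ℕ) : (1 + ‖x‖) ^ n ≤ 2 ^ n * (1 + ‖x‖ ^ 2) ^ n := by
  rw [← mul_pow]
  gcongr
  nlinarith [sq_nonneg (‖x‖ - 1), sq_nonneg ‖x‖]

theorem continuous_jet_trans (n : ℕ) (φ : Schw d) : Continuous fun y => jet n (trans y φ) := by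
  refine continuous_pi fun s => ?_
  obtain ⟨C, hC0, hC⟩ := exists_trans_sub_le (wordD s.1 φ) (2 * n)
  rw [continuous_iff_continuousAt]
  intro y'
  rw [ContinuousAt, tendsto_iff_norm_sub_tendsto_zero]
  have hlim : Tendsto (fun y => C * (2 + ‖y'‖) ^ (2 * n) * ‖y - y'‖) (𝓝 y') (𝓝 0) := by
    have : Continuous fun y => C * (2 + ‖y'‖) ^ (2 * n) * ‖y - y'‖ := by fun_prop
    have h := this.tendsto y'
    simpa using h
  refine squeeze_zero' (Eventually.of_forall fun _ => norm_nonneg _) ?_ hlim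
  filter_upwards [Metric.closedBall_mem_nhds y' one_pos] with y hy
  rw [mem_closedBall_iff_norm] at hy
  rw [BoundedContinuousFunction.norm_le (by positivity)]
  intro x
  rw [BoundedContinuousFunction.sub_apply, jet_apply, jet_apply, ← mul_sub, wordD_trans,
    wordD_trans, trans_apply, trans_apply, norm_mul, Real.norm_of_nonneg (by positivity)]
  refine le_trans ?_ (hC x y y' hy)
  exact mul_le_mul_of_nonneg_right (one_add_sq_le x n) (norm_nonneg _)

theorem exists_jet_trans_le (n : ℕ) (φ : Schw d) :
    ∃ C : ℝ, 0 ≤ C ∧ ∀ y, ‖jet n (trans y φ)‖ ≤ C * (1 + ‖y‖) ^ (2 * n) := by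
  choose C hC0 hC using fun s : words d n => exists_decay_trans (wordD s.1 φ) (2 * n)
  have hS : 0 ≤ ∑ s, C s := Finset.sum_nonneg fun s _ => hC0 s
  refine ⟨∑ s, C s, hS, fun y => ?_⟩
  rw [pi_norm_le_iff_of_nonneg (by positivity)]
  intro s
  rw [BoundedContinuousFunction.norm_le (by positivity)]
  intro x
  rw [jet_apply, wordD_trans, trans_apply, norm_mul, Real.norm_of_nonneg (by positivity)]
  refine (mul_le_mul_of_nonneg_right (one_add_sq_le x n) (norm_nonneg _)).trans ?_
  refine (hC s x y).trans ?_
  gcongr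
  exact Finset.single_le_sum (fun s _ => hC0 s) (Finset.mem_univ s)

/-- A linear functional dominated by the norm of the image under a linear map factors through that
map, by the Hahn-Banach theorem. -/
theorem exists_factor_of_bound {V X : Type*} [AddCommGroup V] [Module ℝ V]
    [NormedAddCommGroup X] [NormedSpace ℝ X] (J : V →ₗ[ℝ] X) (F : V →ₗ[ℝ] ℝ) (C : ℝ)
    (h : ∀ v, |F v| ≤ C * ‖J v‖) : ∃ G : X →L[ℝ] ℝ, ∀ v, F v = G (J v) := by
  obtain ⟨g, hg⟩ := LinearMap.exists_rightInverse_of_surjective _ (LinearMap.range_rangeRestrict J)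
  have hg' : ∀ z, J (g z) = z.1 := fun z => congrArg Subtype.val (LinearMap.congr_fun hg z)
  obtain ⟨G, hG, -⟩ := exists_extension_norm_eq _
    ((F.comp g).mkContinuous C fun z => by
      have := h (g z)
      rw [hg'] at this
      exact this)
  refine ⟨G, fun v => ?_⟩
  have h1 := hG ⟨J v, J.mem_range_self v⟩
  rw [h1]
  have h2 := h (g ⟨J v, J.mem_range_self v⟩ - v)
  rw [map_sub, map_sub, hg', sub_self, norm_zero, mul_zero] at h2
  exact (sub_eq_zero.1 (abs_nonpos_iff.1 h2)).symm

/-- A distribution factors through a continuous functional on a Banach space of finite jets. -/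
theorem exists_functional_on_jet (F : Distr d) :
    ∃ (n : ℕ) (G : (words d n → (SpaceTime d →ᵇ ℝ)) →L[ℝ] ℝ), ∀ φ, F φ = G (jet n φ) := by
  obtain ⟨n, hn⟩ := exists_finite_order (fun φ => ENNReal.ofReal |F φ|) (by
    intro B hB
    have := (NormedSpace.isVonNBounded_iff ℝ).1 (hB.image F)
    obtain ⟨C, hC⟩ := this.exists_norm_le
    refine ⟨C, fun φ hφ => ENNReal.ofReal_le_ofReal ?_⟩
    exact hC _ (Set.mem_image_of_mem _ hφ))
  have hbound1 : ∀ φ : Schw d, ∀ M : ℝ, 0 < M → ‖jet n φ‖ ≤ M → |F φ| ≤ n * 2 ^ n * M := by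
    intro φ M hM hφ
    have hk : 0 < (2 ^ n * M)⁻¹ := by positivity
    have h1 := hn ((2 ^ n * M)⁻¹ • φ) (by
      intro s hs x
      rw [map_smul, smul_apply, smul_eq_mul, abs_mul, abs_of_pos hk]
      have h2 : |(1 + ‖x‖ ^ 2) ^ n * wordD s φ x| ≤ M := by
        have h3 := (jet n φ ⟨s, hs⟩).norm_coe_le_norm x
        rw [jet_apply, Real.norm_eq_abs] at h3
        exact h3.trans ((norm_le_pi_norm _ _).trans hφ)
      rw [abs_mul, abs_of_nonneg (by positivity)] at h2
      have h4 := mul_le_mul_of_nonneg_right (one_add_le_sq x n) (abs_nonneg (wordD s φ x))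
      calc (1 + ‖x‖) ^ n * ((2 ^ n * M)⁻¹ * |wordD s φ x|)
          = (2 ^ n * M)⁻¹ * ((1 + ‖x‖) ^ n * |wordD s φ x|) := by ring
        _ ≤ (2 ^ n * M)⁻¹ * (2 ^ n * M) := by
          refine mul_le_mul_of_nonneg_left (h4.trans ?_) hk.le
          rw [mul_assoc]
          exact mul_le_mul_of_nonneg_left h2 (by positivity)
        _ = 1 := inv_mul_cancel₀ (by positivity))
    rw [← ENNReal.ofReal_natCast, ENNReal.ofReal_le_ofReal_iff (Nat.cast_nonneg _), map_smul,
      smul_eq_mul, abs_mul, abs_of_pos hk, inv_mul_le_iff₀ (by positivity)] at h1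
    linarith
  have hbound : ∀ φ : Schw d, |F φ| ≤ n * 2 ^ n * ‖jet n φ‖ := by
    intro φ
    refine le_of_forall_pos_le_add fun ε hε => ?_
    have hpos : (0 : ℝ) < n * 2 ^ n + 1 := by positivity
    have h1 := hbound1 φ (‖jet n φ‖ + ε / (n * 2 ^ n + 1)) (by positivity)
      (le_add_of_nonneg_right (by positivity))
    refine h1.trans ?_
    rw [mul_add]
    gcongr
    rw [mul_div_assoc', div_le_iff₀ hpos]
    nlinarith
  obtain ⟨G, hG⟩ := exists_factor_of_bound (jet (d := d) n).toLinearMap F.toLinearMap _ hbound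
  exact ⟨n, G, hG⟩

theorem continuous_apply_trans (F : Distr d) (φ : Schw d) : Continuous fun y => F (trans y φ) := by
  obtain ⟨n, G, hG⟩ := exists_functional_on_jet F
  simp only [hG]
  exact G.continuous.comp (continuous_jet_trans n φ)

/-- A distribution may be exchanged with the integral defining a convolution. -/
theorem apply_conv (F : Distr d) (ψ φ : Schw d) :
    F (conv ψ φ) = ∫ y, ψ y * F (trans y φ) := by
  obtain ⟨n, G, hG⟩ := exists_functional_on_jet F
  have hint : Integrable fun y => ψ y • jet n (trans y φ) := by
    obtain ⟨C, hC0, hC⟩ := exists_jet_trans_le n φ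
    obtain ⟨C', hC'0, hC'⟩ := exists_decay ψ (d + 2 + 2 * n)
    refine (integrable_inv_bracket.const_mul (C' * C)).mono'
      ((ψ.continuous.smul (continuous_jet_trans n φ)).aestronglyMeasurable)
      (Eventually.of_forall fun y => ?_)
    rw [norm_smul, Real.norm_eq_abs, ← div_eq_mul_inv, le_div_iff₀ (by positivity)]
    calc |ψ y| * ‖jet n (trans y φ)‖ * (1 + ‖y‖) ^ (d + 2)
        ≤ |ψ y| * (C * (1 + ‖y‖) ^ (2 * n)) * (1 + ‖y‖) ^ (d + 2) := by
          gcongr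
          exact hC y
      _ = ((1 + ‖y‖) ^ (d + 2 + 2 * n) * |ψ y|) * C := by rw [pow_add _ (d + 2)]; ring
      _ ≤ C' * C := by gcongr; exact hC' y
  have hI : jet n (conv ψ φ) = ∫ y, ψ y • jet n (trans y φ) := by
    ext s x
    have h1 := ((BoundedContinuousFunction.evalCLM ℝ x).comp
      (ContinuousLinearMap.proj (R := ℝ) (φ := fun _ : words d n => SpaceTime d →ᵇ ℝ) s)
      ).integral_comp_comm hint
    simp only [ContinuousLinearMap.comp_apply, ContinuousLinearMap.proj_apply,
      BoundedContinuousFunction.evalCLM_apply] at h1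
    rw [← h1, jet_apply, wordD_conv, conv_apply, ← integral_const_mul]
    congr 1
    ext y
    rw [Pi.smul_apply, BoundedContinuousFunction.smul_apply, jet_apply, wordD_trans, trans_apply,
      smul_eq_mul]
    ring
  rw [hG, hI, ← G.integral_comp_comm hint]
  simp only [hG, map_smul, smul_eq_mul]

/-! ### Uniform domination of random distributions -/

/-- The smoothing kernel at the small scale `2 ^ (-k)`. -/
def smallKernel (d : ℕ) (k : ℕ) : Schw d := rescale (dyadic (-k)) (kernel d)

theorem coe_dyadic_neg (k : ℕ) : (dyadic (-k) : ℝ) = (2⁻¹ : ℝ) ^ k := by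
  rw [coe_dyadic, zpow_neg, zpow_natCast, inv_pow]

theorem coe_dyadic_neg_le_one (k : ℕ) : (dyadic (-k) : ℝ) ≤ 1 := by
  rw [coe_dyadic_neg]
  exact pow_le_one₀ (by norm_num) (by norm_num)

/-- Smoothing at scale `2 ^ (-k)` is the identity up to an error of any prescribed algebraic order,
because all moments of the kernel except the zeroth vanish. -/
theorem exists_conv_smallKernel (M : ℕ) (hM : M ≠ 0) {B : Set (Schw d)}
    (hB : Bornology.IsVonNBounded ℝ B) : ∃ E : Set (Schw d), Bornology.IsVonNBounded ℝ E ∧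
      ∀ φ ∈ B, ∀ k : ℕ, ∃ e ∈ E, conv (smallKernel d k) φ = φ + ((2⁻¹ : ℝ) ^ k) ^ M • e := by
  refine ⟨_, isVonNBounded_taylorRem M (Bornology.isVonNBounded_singleton (kernel d)) hB,
    fun φ hφ k => ⟨_, ⟨kernel d, rfl, φ, hφ, dyadic (-k), coe_dyadic_neg_le_one k, rfl⟩, ?_⟩⟩
  have h0 : ((2⁻¹ : ℝ) ^ k) ^ M ≠ 0 := by positivity
  rw [coe_dyadic_neg, smul_smul, mul_inv_cancel₀ h0, one_smul, taylorRem_kernel hM, smallKernel]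
  abel

theorem exists_abs_apply_le (F : Distr d) {B : Set (Schw d)} (hB : Bornology.IsVonNBounded ℝ B) :
    ∃ C : ℝ, 0 ≤ C ∧ ∀ φ ∈ B, |F φ| ≤ C := by
  obtain ⟨C, hC⟩ := ((NormedSpace.isVonNBounded_iff ℝ).1 (hB.image F)).exists_norm_le
  exact ⟨max C 0, le_max_right _ _, fun φ hφ =>
    (hC _ (Set.mem_image_of_mem _ hφ)).trans (le_max_left _ _)⟩

theorem tendsto_apply_conv_smallKernel (F : Distr d) (φ : Schw d) :
    Tendsto (fun k => F (conv (smallKernel d k) φ)) atTop (𝓝 (F φ)) := by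
  obtain ⟨E, hE, h⟩ := exists_conv_smallKernel 1 one_ne_zero (Bornology.isVonNBounded_singleton φ)
  obtain ⟨C, -, hC⟩ := exists_abs_apply_le F hE
  rw [tendsto_iff_norm_sub_tendsto_zero]
  have hlim : Tendsto (fun k : ℕ => (2⁻¹ : ℝ) ^ k * C) atTop (𝓝 0) := by
    simpa using (tendsto_pow_atTop_nhds_zero_of_lt_one (r := (2⁻¹ : ℝ)) (by norm_num)
      (by norm_num)).mul_const C
  refine squeeze_zero (fun _ => norm_nonneg _) (fun k => ?_) hlim
  obtain ⟨e, he, hk⟩ := h φ rfl k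
  rw [hk, map_add, add_sub_cancel_left, map_smul, norm_smul, pow_one,
    Real.norm_of_nonneg (by positivity)]
  gcongr
  exact hC e he

theorem tendsto_apply_conv_conv_smallKernel (F : Distr d) (φ : Schw d) :
    Tendsto (fun k => F (conv (smallKernel d k) (conv (smallKernel d k) φ))) atTop (𝓝 (F φ)) := by
  obtain ⟨E, hE, h⟩ := exists_conv_smallKernel 1 one_ne_zero (Bornology.isVonNBounded_singleton φ)
  obtain ⟨E', hE', h'⟩ := exists_conv_smallKernel 1 one_ne_zero hE
  obtain ⟨C, hC0, hC⟩ := exists_abs_apply_le F hE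
  obtain ⟨C', hC'0, hC'⟩ := exists_abs_apply_le F hE'
  rw [tendsto_iff_norm_sub_tendsto_zero]
  have hlim : Tendsto (fun k : ℕ => (2⁻¹ : ℝ) ^ k * (2 * C + C')) atTop (𝓝 0) := by
    simpa using (tendsto_pow_atTop_nhds_zero_of_lt_one (r := (2⁻¹ : ℝ)) (by norm_num)
      (by norm_num)).mul_const (2 * C + C')
  refine squeeze_zero (fun _ => norm_nonneg _) (fun k => ?_) hlim
  obtain ⟨e, he, hk⟩ := h φ rfl k
  obtain ⟨e', he', hk'⟩ := h' e he k
  have hq0 : (0 : ℝ) ≤ (2⁻¹ : ℝ) ^ k := by positivity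
  have hq1 : (2⁻¹ : ℝ) ^ k ≤ 1 := pow_le_one₀ (by norm_num) (by norm_num)
  have e1 : F (conv (smallKernel d k) (conv (smallKernel d k) φ)) - F φ
      = (2⁻¹ : ℝ) ^ k * (2 * F e + (2⁻¹ : ℝ) ^ k * F e') := by
    rw [hk, map_add, map_smul, hk, hk']
    simp only [map_add, map_smul, smul_eq_mul, pow_one]
    ring
  rw [e1, norm_mul, Real.norm_of_nonneg hq0, Real.norm_eq_abs]
  gcongr
  refine (abs_add_le _ _).trans ?_
  rw [abs_mul, abs_mul, abs_two, abs_of_nonneg hq0]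
  have h1 := hC e he
  have h2 := hC' e' he'
  have h3 := mul_le_of_le_one_left (abs_nonneg (F e')) hq1
  linarith

/-- The weighted average of the translates of a distribution mollified at scale `2 ^ (-k)`. -/
def meanAbs (N k : ℕ) (F : Distr d) : ℝ≥0∞ :=
  ∫⁻ y, ENNReal.ofReal (((1 + ‖y‖) ^ N)⁻¹ * |F (trans y (smallKernel d k))|)

theorem ofReal_abs_apply_conv_le {N : ℕ} (k : ℕ) (F : Distr d) (θ : Schw d) {c : ℝ} (hc : 0 ≤ c)
    (h : ∀ y, (1 + ‖y‖) ^ N * |θ y| ≤ c) :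
    ENNReal.ofReal |F (conv (smallKernel d k) θ)| ≤ ENNReal.ofReal c * meanAbs N k F := by
  have h1 : ENNReal.ofReal |F (conv (smallKernel d k) θ)|
      ≤ ∫⁻ y, ENNReal.ofReal |θ y * F (trans y (smallKernel d k))| := by
    rw [conv_comm, apply_conv]
    have := enorm_integral_le_lintegral_enorm
      (μ := volume) fun y => θ y * F (trans y (smallKernel d k))
    simpa only [Real.enorm_eq_ofReal_abs] using this
  refine h1.trans ?_
  rw [meanAbs, ← lintegral_const_mul' _ _ ENNReal.ofReal_ne_top]
  refine lintegral_mono fun y => ?_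
  rw [← ENNReal.ofReal_mul hc]
  refine ENNReal.ofReal_le_ofReal ?_
  rw [abs_mul, ← mul_assoc, ← div_eq_mul_inv]
  gcongr
  rw [le_div_iff₀ (by positivity), mul_comm]
  exact h y

/-- On a bounded set of test functions, a distribution is dominated by its mollified averages.
This follows by telescoping `φ = lim S_k S_k φ`, where `S_k` is smoothing at scale `2 ^ (-k)`. -/
theorem exists_ofReal_abs_apply_le (M N : ℕ) (hM : M ≠ 0) {B : Set (Schw d)}
    (hB : Bornology.IsVonNBounded ℝ B) : ∃ C : ℝ, 0 ≤ C ∧ ∀ F : Distr d, ∀ φ ∈ B,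
      ENNReal.ofReal |F φ| ≤ ENNReal.ofReal C * meanAbs N 0 F
        + ∑' k : ℕ, ENNReal.ofReal (C * ((2⁻¹ : ℝ) ^ k) ^ M)
          * (meanAbs N (k + 1) F + meanAbs N k F) := by
  obtain ⟨E, hE, h⟩ := exists_conv_smallKernel M hM hB
  obtain ⟨C₁, hC₁0, hC₁⟩ := exists_decay_of_isVonNBounded hB N
  obtain ⟨C₂, hC₂0, hC₂⟩ := exists_decay_of_isVonNBounded hE N
  refine ⟨C₁ + 2 * C₂, by positivity, fun F φ hφ => ?_⟩
  set C := C₁ + 2 * C₂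
  set S : ℕ → Schw d → Schw d := fun k => conv (smallKernel d k) with hS
  set b : ℕ → ℝ≥0∞ := fun k => ENNReal.ofReal (C * ((2⁻¹ : ℝ) ^ k) ^ M)
    * (meanAbs N (k + 1) F + meanAbs N k F) with hb
  have hpart : ∀ K : ℕ, ENNReal.ofReal |F (S K (S K φ))|
      ≤ ENNReal.ofReal C * meanAbs N 0 F + ∑ k ∈ Finset.range K, b k := by
    intro K
    induction K with
    | zero =>
      rw [Finset.sum_range_zero, add_zero]
      refine ofReal_abs_apply_conv_le 0 F _ (by positivity) fun y => ?_
      obtain ⟨e, he, hk⟩ := h φ hφ 0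
      simp only [hS]
      rw [hk, pow_zero, one_pow, one_smul, add_apply]
      calc (1 + ‖y‖) ^ N * |φ y + e y| ≤ (1 + ‖y‖) ^ N * (|φ y| + |e y|) := by
            gcongr; exact abs_add_le _ _
        _ = (1 + ‖y‖) ^ N * |φ y| + (1 + ‖y‖) ^ N * |e y| := mul_add _ _ _
        _ ≤ C₁ + 2 * C₂ := by linarith [hC₁ φ hφ y, hC₂ e he y]
    | succ K ih =>
      have hsplit : S (K + 1) (S (K + 1) φ) = S K (S K φ)
          + (S (K + 1) (S (K + 1) φ - S K φ) + S K (S (K + 1) φ - S K φ)) := by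
        simp only [hS, map_sub]
        rw [conv_left_comm (smallKernel d (K + 1)) (smallKernel d K) φ]
        abel
      have hθ : ∀ y, (1 + ‖y‖) ^ N * |(S (K + 1) φ - S K φ) y|
          ≤ C * ((2⁻¹ : ℝ) ^ K) ^ M := by
        intro y
        obtain ⟨e, he, hk⟩ := h φ hφ K
        obtain ⟨e', he', hk'⟩ := h φ hφ (K + 1)
        simp only [hS]
        rw [hk, hk', add_sub_add_left_eq_sub, sub_apply, smul_apply, smul_apply, smul_eq_mul,
          smul_eq_mul]
        set q : ℝ := ((2⁻¹ : ℝ) ^ K) ^ M with hq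
        have hq0 : 0 ≤ q := by positivity
        have hq' : ((2⁻¹ : ℝ) ^ (K + 1)) ^ M ≤ q := by
          rw [hq, pow_succ]
          gcongr
          exact mul_le_of_le_one_right (by positivity) (by norm_num)
        have hq'0 : (0 : ℝ) ≤ ((2⁻¹ : ℝ) ^ (K + 1)) ^ M := by positivity
        calc (1 + ‖y‖) ^ N * |((2⁻¹ : ℝ) ^ (K + 1)) ^ M * e' y - q * e y|
            ≤ (1 + ‖y‖) ^ N * (q * |e' y| + q * |e y|) := by
              gcongr
              refine (abs_sub _ _).trans ?_
              rw [abs_mul, abs_mul, abs_of_nonneg hq0, abs_of_nonneg hq'0]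
              gcongr
          _ = q * ((1 + ‖y‖) ^ N * |e' y|) + q * ((1 + ‖y‖) ^ N * |e y|) := by ring
          _ ≤ q * C₂ + q * C₂ := by
              gcongr
              · exact hC₂ e' he' y
              · exact hC₂ e he y
          _ ≤ C * q := by
              have := mul_nonneg hC₁0 hq0
              simp only [C]
              linarith
      have hc : 0 ≤ C * ((2⁻¹ : ℝ) ^ K) ^ M := by positivity
      rw [Finset.sum_range_succ, ← add_assoc, hsplit, map_add F, map_add F]
      refine (ENNReal.ofReal_le_ofReal (abs_add_le _ _)).trans ?_
      rw [ENNReal.ofReal_add (abs_nonneg _) (abs_nonneg _)]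
      refine add_le_add ih ?_
      refine (ENNReal.ofReal_le_ofReal (abs_add_le _ _)).trans ?_
      rw [ENNReal.ofReal_add (abs_nonneg _) (abs_nonneg _)]
      simp only [hb, mul_add]
      exact add_le_add (ofReal_abs_apply_conv_le _ F _ hc hθ)
        (ofReal_abs_apply_conv_le _ F _ hc hθ)
  have hlim := (ENNReal.continuous_ofReal.comp continuous_abs).continuousAt.tendsto.comp
    (tendsto_apply_conv_conv_smallKernel F φ)
  refine le_of_tendsto hlim (Eventually.of_forall fun K => (hpart K).trans ?_)
  gcongr
  exact ENNReal.sum_le_tsum _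

theorem le_dilation_symm_norm {r : Scale} (hr : (r : ℝ) ≤ 1) (x : SpaceTime d) :
    ‖x‖ ≤ ‖(dilation d r).symm x‖ := by
  have h := norm_dil_le (le_of_lt r.2) hr ((dilation d r).symm x)
  rwa [dil_eq_dilation, ContinuousLinearEquiv.apply_symm_apply] at h

/-- The weighted derivatives of the translated small-scale kernels grow at most algebraically. -/
theorem exists_trans_smallKernel_bound (n : ℕ) : ∃ C : ℝ, 0 < C ∧ ∀ k : ℕ, ∀ y : SpaceTime d,
    ∀ s ∈ words d n, ∀ x, (1 + ‖x‖) ^ n * |wordD s (trans y (smallKernel d k)) x|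
      ≤ C * ((2 : ℝ) ^ k) ^ (d + 2 + n) * (1 + ‖y‖) ^ n := by
  choose C hC0 hC using fun s : List (Fin (d + 1)) => exists_decay (wordD s (kernel d)) n
  have hS : 0 ≤ ∑ s ∈ words d n, C s := Finset.sum_nonneg fun s _ => hC0 s
  refine ⟨∑ s ∈ words d n, C s + 1, by positivity, fun k y s hs x => ?_⟩
  have hCs : C s ≤ ∑ s ∈ words d n, C s + 1 := by
    linarith [Finset.single_le_sum (fun s _ => hC0 s) hs]
  have hinv : ∀ m : ℕ, ((dyadic (-k) : ℝ) ^ m)⁻¹ = ((2 : ℝ) ^ k) ^ m := by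
    intro m
    rw [coe_dyadic_neg, inv_pow, inv_pow, inv_inv]
  set z := (dilation d (dyadic (-k))).symm (x - y)
  have hz : 1 + ‖x‖ ≤ (1 + ‖z‖) * (1 + ‖y‖) :=
    (one_add_norm_le x y).trans (by
      gcongr
      exact le_dilation_symm_norm (coe_dyadic_neg_le_one k) _)
  have h2 : (1 : ℝ) ≤ (2 : ℝ) ^ k := one_le_pow₀ (by norm_num)
  rw [wordD_trans, trans_apply, smallKernel, wordD_rescale, smul_apply, rescale_apply', hinv, hinv,
    smul_eq_mul, abs_mul, abs_mul, abs_of_nonneg (by positivity), abs_of_nonneg (by positivity)]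
  calc (1 + ‖x‖) ^ n * (((2 : ℝ) ^ k) ^ order s * (((2 : ℝ) ^ k) ^ (d + 2)
          * |wordD s (kernel d) z|))
      ≤ ((1 + ‖z‖) * (1 + ‖y‖)) ^ n * (((2 : ℝ) ^ k) ^ n * (((2 : ℝ) ^ k) ^ (d + 2)
          * |wordD s (kernel d) z|)) := by
        have := (order_lt_of_mem_words hs).le
        have h3 : ((2 : ℝ) ^ k) ^ order s ≤ ((2 : ℝ) ^ k) ^ n := pow_le_pow_right₀ h2 this
        gcongr
    _ = ((1 + ‖z‖) ^ n * |wordD s (kernel d) z|) * ((2 : ℝ) ^ k) ^ (d + 2 + n)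
          * (1 + ‖y‖) ^ n := by rw [mul_pow, pow_add _ (d + 2)]; ring
    _ ≤ _ := by
        gcongr
        exact (hC s z).trans hCs

/-- If the moments of a family of random distributions are bounded on bounded sets of test
functions, then so are the moments of the suprema over a bounded set of test functions: a
quantitative form of the nuclearity of Schwartz space. -/
theorem exists_uniform_domination {Ω ι : Type*} [MeasurableSpace Ω] (P : Measure Ω) [SFinite P]
    (F : ι → Ω → Distr d) (hm : ∀ i φ, Measurable fun ω => F i ω φ)
    (hb : ∀ B : Set (Schw d), Bornology.IsVonNBounded ℝ B → ∃ C : ℝ, ∀ φ ∈ B, ∀ i,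
      ∫⁻ ω, ENNReal.ofReal |F i ω φ| ∂P ≤ ENNReal.ofReal C)
    {B : Set (Schw d)} (hB : Bornology.IsVonNBounded ℝ B) :
    ∃ (C : ℝ) (X : ι → Ω → ℝ≥0∞), (∀ i, Measurable (X i)) ∧
      (∀ i ω, ∀ φ ∈ B, ENNReal.ofReal |F i ω φ| ≤ X i ω) ∧
      ∀ i, ∫⁻ ω, X i ω ∂P ≤ ENNReal.ofReal C := by
  obtain ⟨n, hn⟩ := exists_finite_order (fun φ => ⨆ i, ∫⁻ ω, ENNReal.ofReal |F i ω φ| ∂P) (by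
    intro B hB
    obtain ⟨C, hC⟩ := hb B hB
    exact ⟨C, fun φ hφ => iSup_le (hC φ hφ)⟩)
  obtain ⟨K, hK0, hK⟩ := exists_trans_smallKernel_bound (d := d) n
  -- The weight `N` compensates the growth `n` of the translated kernels up to an integrable factor,
  -- and the order `M` exceeds by one the growth in `2 ^ k` of their weighted derivatives.
  set N := d + 2 + n with hN
  set M := d + 2 + n + 1 with hM
  obtain ⟨C, hC0, hC⟩ := exists_ofReal_abs_apply_le M N (Nat.succ_ne_zero _) hB
  have hjoint : ∀ i k, Measurable fun q : Ω × SpaceTime d =>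
      ENNReal.ofReal (((1 + ‖q.2‖) ^ N)⁻¹ * |F i q.1 (trans q.2 (smallKernel d k))|) := by
    intro i k
    have h1 : Measurable (Function.uncurry fun (y : SpaceTime d) (ω : Ω) =>
        F i ω (trans y (smallKernel d k))) :=
      measurable_uncurry_of_continuous_of_measurable
        (fun ω => continuous_apply_trans (F i ω) _) (fun y => hm i _)
    have h2 : Measurable fun q : Ω × SpaceTime d => F i q.1 (trans q.2 (smallKernel d k)) :=
      h1.comp measurable_swap
    have h3 : Measurable fun q : Ω × SpaceTime d => ((1 + ‖q.2‖) ^ N)⁻¹ := by fun_prop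
    exact ENNReal.measurable_ofReal.comp (h3.mul (measurable_norm.comp h2))
  have hmean : ∀ i k, Measurable fun ω => meanAbs N k (F i ω) := fun i k =>
    (hjoint i k).lintegral_prod_right'
  set J : ℝ := ∫ y : SpaceTime d, ((1 + ‖y‖) ^ (d + 2))⁻¹ with hJ
  have hJ0 : 0 ≤ J := integral_nonneg fun y => by positivity
  have hexp : ∀ i k, ∫⁻ ω, meanAbs N k (F i ω) ∂P
      ≤ ENNReal.ofReal (n * K * J * ((2 : ℝ) ^ k) ^ (d + 2 + n)) := by
    intro i k
    set Q : ℝ := ((2 : ℝ) ^ k) ^ (d + 2 + n) with hQ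
    have hQ0 : 0 < Q := by positivity
    simp only [meanAbs]
    rw [lintegral_lintegral_swap (hjoint i k).aemeasurable]
    have hy : ∀ y : SpaceTime d,
        ∫⁻ ω, ENNReal.ofReal (((1 + ‖y‖) ^ N)⁻¹ * |F i ω (trans y (smallKernel d k))|) ∂P
          ≤ ENNReal.ofReal (n * K * Q * ((1 + ‖y‖) ^ (d + 2))⁻¹) := by
      intro y
      set m : ℝ := K * Q * (1 + ‖y‖) ^ n with hmdef
      have hm0 : 0 < m := by positivity
      -- Normalised by `m`, the translated kernel belongs to the unit ball on which the order `n`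
      -- of the moments is tested.
      have h1 := hn (m⁻¹ • trans y (smallKernel d k)) (by
        intro s hs x
        rw [map_smul, smul_apply, smul_eq_mul, abs_mul, abs_of_pos (inv_pos.2 hm0),
          mul_left_comm, inv_mul_le_iff₀ hm0, mul_one]
        exact hK k y s hs x)
      have h2 := (le_iSup (fun i => ∫⁻ ω, ENNReal.ofReal
        |F i ω (m⁻¹ • trans y (smallKernel d k))| ∂P) i).trans h1
      simp only [map_smul, smul_eq_mul, abs_mul, abs_of_pos (inv_pos.2 hm0),
        ENNReal.ofReal_mul (inv_pos.2 hm0).le] at h2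
      have hpos : (0 : ℝ) ≤ ((1 + ‖y‖) ^ N)⁻¹ * m := by positivity
      calc ∫⁻ ω, ENNReal.ofReal (((1 + ‖y‖) ^ N)⁻¹ * |F i ω (trans y (smallKernel d k))|) ∂P
          = ∫⁻ ω, ENNReal.ofReal (((1 + ‖y‖) ^ N)⁻¹ * m) * (ENNReal.ofReal m⁻¹ *
              ENNReal.ofReal |F i ω (trans y (smallKernel d k))|) ∂P := by
            congr 1
            ext ω
            rw [← ENNReal.ofReal_mul (inv_pos.2 hm0).le, ← ENNReal.ofReal_mul hpos]
            congr 1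
            field_simp
        _ ≤ ENNReal.ofReal (((1 + ‖y‖) ^ N)⁻¹ * m) * n := by
            rw [lintegral_const_mul' _ _ ENNReal.ofReal_ne_top]
            gcongr
        _ = ENNReal.ofReal (n * K * Q * ((1 + ‖y‖) ^ (d + 2))⁻¹) := by
            rw [← ENNReal.ofReal_natCast, ← ENNReal.ofReal_mul hpos]
            congr 1
            rw [hmdef, hN, pow_add _ (d + 2)]
            field_simp
    refine (lintegral_mono hy).trans ?_
    rw [← ofReal_integral_eq_lintegral_ofReal (integrable_inv_bracket.const_mul _)
      (Eventually.of_forall fun y => by positivity), integral_const_mul, ← hJ]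
    refine ENNReal.ofReal_le_ofReal (le_of_eq ?_)
    ring
  set A : ℝ := n * K * J with hA
  have hA0 : 0 ≤ A := by positivity
  set X : ι → Ω → ℝ≥0∞ := fun i ω => ENNReal.ofReal C * meanAbs N 0 (F i ω)
    + ∑' k : ℕ, ENNReal.ofReal (C * ((2⁻¹ : ℝ) ^ k) ^ M)
      * (meanAbs N (k + 1) (F i ω) + meanAbs N k (F i ω)) with hX
  have hsummable : Summable fun k : ℕ => 2 * C * A * 2 ^ (d + 2 + n) * (2⁻¹ : ℝ) ^ k :=
    (summable_geometric_of_lt_one (by norm_num) (by norm_num)).mul_left _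
  have hadd : ∀ i k, Measurable fun ω => meanAbs N (k + 1) (F i ω) + meanAbs N k (F i ω) :=
    fun i k => (hmean i (k + 1)).add (hmean i k)
  refine ⟨C * A + ∑' k : ℕ, 2 * C * A * 2 ^ (d + 2 + n) * (2⁻¹ : ℝ) ^ k, X, fun i => ?_,
    fun i ω φ hφ => hC (F i ω) φ hφ, fun i => ?_⟩
  · exact ((hmean i 0).const_mul _).add
      (Measurable.tsum fun k => (hadd i k).const_mul _)
  · simp only [hX]
    rw [lintegral_add_left ((hmean i 0).const_mul _), lintegral_const_mul _ (hmean i 0),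
      lintegral_tsum fun k => ((hadd i k).const_mul _).aemeasurable,
      ENNReal.ofReal_add (by positivity) (tsum_nonneg fun k => by positivity),
      ENNReal.ofReal_tsum_of_nonneg (fun k => by positivity) hsummable]
    refine add_le_add ?_ (ENNReal.tsum_le_tsum fun k => ?_)
    · rw [ENNReal.ofReal_mul hC0]
      gcongr
      refine (hexp i 0).trans_eq ?_
      simp [hA]
    · rw [lintegral_const_mul _ (hadd i k),
        lintegral_add_left (hmean i (k + 1))]
      have hq : (0 : ℝ) ≤ C * ((2⁻¹ : ℝ) ^ k) ^ M := by positivity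
      refine (mul_le_mul_right (add_le_add (hexp i (k + 1)) (hexp i k)) _).trans ?_
      rw [← ENNReal.ofReal_add (by positivity) (by positivity), ← ENNReal.ofReal_mul hq]
      refine ENNReal.ofReal_le_ofReal ?_
      have h1 : ((2 : ℝ) ^ k) ^ (d + 2 + n) ≤ ((2 : ℝ) ^ (k + 1)) ^ (d + 2 + n) := by
        gcongr
        · norm_num
        · omega
      have h2 : ((2⁻¹ : ℝ) ^ k) ^ M * ((2 : ℝ) ^ (k + 1)) ^ (d + 2 + n)
          = 2 ^ (d + 2 + n) * (2⁻¹ : ℝ) ^ k := by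
        rw [hM, pow_succ _ (d + 2 + n), pow_succ (2 : ℝ) k, mul_pow ((2 : ℝ) ^ k), inv_pow, inv_pow]
        field_simp
      calc C * ((2⁻¹ : ℝ) ^ k) ^ M
            * (A * ((2 : ℝ) ^ (k + 1)) ^ (d + 2 + n) + A * ((2 : ℝ) ^ k) ^ (d + 2 + n))
          ≤ C * ((2⁻¹ : ℝ) ^ k) ^ M
            * (A * ((2 : ℝ) ^ (k + 1)) ^ (d + 2 + n) + A * ((2 : ℝ) ^ (k + 1)) ^ (d + 2 + n)) := by
            gcongr
        _ = 2 * C * A * (((2⁻¹ : ℝ) ^ k) ^ M * ((2 : ℝ) ^ (k + 1)) ^ (d + 2 + n)) := by ring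
        _ = _ := by rw [h2]; ring

/-! ### Summation over the atoms -/

/-- One step of the telescoping: for an operator `T` that commutes with the heat operator and
preserves good functions, testing `U` with the dyadic difference of `T` applied to the kernel is
testing the right-hand side `G` with `T` applied to the potential. -/
theorem apply_kernel_sub_apply_kernel {U G : Distr d}
    (hUG : ∀ φ, Good φ → U (heat φ) = G φ) (T : Schw d →L[ℝ] Schw d)
    (hT : ∀ φ, heat (T φ) = T (heat φ)) (hgood : ∀ φ, Good φ → Good (T φ)) (k : ℤ) :
    U (T (rescale (dyadic k) (kernel d))) - U (T (rescale (dyadic (k + 1)) (kernel d)))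
      = ((2 : ℝ) ^ k) ^ 2 * G (T (rescale (dyadic k) (potential d))) := by
  have hk : ((2 : ℝ) ^ k) ^ 2 ≠ 0 := by positivity
  have h1 : rescale (dyadic k) (kernel d) - rescale (dyadic (k + 1)) (kernel d)
      = ((2 : ℝ) ^ k) ^ 2 • heat (rescale (dyadic k) (potential d)) := by
    rw [heat_rescale, smul_smul, coe_dyadic, mul_inv_cancel₀ hk, one_smul, heat_potential,
      ← rescale_dyadic_dyadic, ← rescaleL_apply, ← rescaleL_apply, ← rescaleL_apply, ← map_sub]
    rfl
  rw [← map_sub, ← map_sub, h1, map_smul, map_smul, smul_eq_mul, ← hT,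
    hUG _ (hgood _ (good_potential.rescale _))]

/-- Index set of the atoms: small scales, large scales, and the Taylor terms on small scales. -/
abbrev AtomIdx (d W : ℕ) : Type := ℕ ⊕ ℕ ⊕ (words d W × ℕ)

/-- The masses of the atoms: the square of the scale, which is the gain of inverting the heat operator,
times the factor by which the test function has been normalised. -/
def atomWeight {W : ℕ} : AtomIdx d W → ℝ
  | .inl j => ((2 : ℝ) ^ (-(j + 1 : ℤ))) ^ 2
  | .inr (.inl n) => ((2 : ℝ) ^ (n : ℤ)) ^ 2 * ((2 : ℝ) ^ (-(n : ℤ))) ^ W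
  | .inr (.inr (s, j)) =>
      ((2 : ℝ) ^ (-(j + 1 : ℤ))) ^ 2 * (((2 : ℝ) ^ (-(j + 1 : ℤ))) ^ order s.1)⁻¹

/-- The dyadic exponents of the scales of the atoms. -/
def atomExp {W : ℕ} : AtomIdx d W → ℤ
  | .inl _ => 0
  | .inr (.inl n) => n
  | .inr (.inr (_, j)) => -(j + 1 : ℤ)

/-- The test functions of the atoms. On small scales these are the convolutions of `ψ` with the
rescaled potential, which vary on scale one. On large scales they are the Taylor remainders, seen at
the scale of the potential and normalised by their size. The third family consists of the Taylor
terms on small scales, also seen at the scale of the potential. -/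
def atom {W : ℕ} (ψ : Schw d) : AtomIdx d W → Schw d
  | .inl j => conv ψ (rescale (dyadic (-(j + 1 : ℤ))) (potential d))
  | .inr (.inl n) =>
      (((2 : ℝ) ^ (-(n : ℤ))) ^ W)⁻¹ • taylorRem W (rescale (dyadic (-(n : ℤ))) ψ) (potential d)
  | .inr (.inr (s, _)) => (-(taylorCoeff s.1 * moment s.1 ψ)) • wordD s.1 (potential d)

theorem atomWeight_nonneg {W : ℕ} (i : AtomIdx d W) : 0 ≤ atomWeight i := by
  rcases i with j | n | ⟨s, j⟩ <;> simp only [atomWeight] <;> positivity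

theorem smallKernel_eq (k : ℕ) : smallKernel d k = rescale (dyadic (-(k : ℤ))) (kernel d) := rfl

/-- Telescoping over the scales below one. -/
theorem hasSum_small {U G : Distr d} (hUG : ∀ φ, Good φ → U (heat φ) = G φ)
    (T : Schw d →L[ℝ] Schw d) (hT : ∀ φ, heat (T φ) = T (heat φ))
    (hgood : ∀ φ, Good φ → Good (T φ)) {a : ℝ}
    (hlim : Tendsto (fun k => U (T (smallKernel d k))) atTop (𝓝 a))
    (hsum : Summable fun j : ℕ => ((2 : ℝ) ^ (-(j + 1 : ℤ))) ^ 2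
      * G (T (rescale (dyadic (-(j + 1 : ℤ))) (potential d)))) :
    HasSum (fun j : ℕ => ((2 : ℝ) ^ (-(j + 1 : ℤ))) ^ 2
      * G (T (rescale (dyadic (-(j + 1 : ℤ))) (potential d))))
      (a - U (T (smallKernel d 0))) := by
  rw [hsum.hasSum_iff_tendsto_nat]
  refine (hlim.sub_const (U (T (smallKernel d 0)))).congr fun K => ?_
  rw [← Finset.sum_range_sub (fun k => U (T (smallKernel d k)))]
  refine Finset.sum_congr rfl fun j _ => ?_
  rw [← apply_kernel_sub_apply_kernel hUG T hT hgood, smallKernel_eq, smallKernel_eq]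
  congr 5
  ring

/-- Telescoping over the scales from one on. -/
theorem hasSum_large {U G : Distr d} (hUG : ∀ φ, Good φ → U (heat φ) = G φ)
    (T : Schw d →L[ℝ] Schw d) (hT : ∀ φ, heat (T φ) = T (heat φ))
    (hgood : ∀ φ, Good φ → Good (T φ))
    (hlim : Tendsto (fun n : ℕ => U (T (rescale (dyadic n) (kernel d)))) atTop (𝓝 0))
    (hsum : Summable fun n : ℕ => ((2 : ℝ) ^ (n : ℤ)) ^ 2
      * G (T (rescale (dyadic n) (potential d)))) :
    HasSum (fun n : ℕ => ((2 : ℝ) ^ (n : ℤ)) ^ 2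
      * G (T (rescale (dyadic n) (potential d)))) (U (T (smallKernel d 0))) := by
  rw [hsum.hasSum_iff_tendsto_nat]
  have h0 := hlim.const_sub (U (T (smallKernel d 0)))
  rw [sub_zero] at h0
  refine h0.congr fun K => ?_
  have h1 := Finset.sum_range_sub' (fun n : ℕ => U (T (rescale (dyadic n) (kernel d)))) K
  have h2 : smallKernel d 0 = rescale (dyadic (0 : ℕ)) (kernel d) := rfl
  rw [h2, ← h1]
  refine Finset.sum_congr rfl fun n _ => ?_
  rw [← apply_kernel_sub_apply_kernel hUG T hT hgood]
  rfl

/-- The contribution of an atom. -/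
def atomTerm {W : ℕ} (G : Distr d) (ψ : Schw d) (i : AtomIdx d W) : ℝ :=
  atomWeight i * G (rescale (dyadic (atomExp i)) (atom ψ i))

theorem atomTerm_inl {W : ℕ} (G : Distr d) (ψ : Schw d) (j : ℕ) :
    atomTerm (W := W) G ψ (.inl j) = ((2 : ℝ) ^ (-(j + 1 : ℤ))) ^ 2
      * G (conv ψ (rescale (dyadic (-(j + 1 : ℤ))) (potential d))) := by
  simp only [atomTerm, atomWeight, atomExp, atom]
  rw [rescale_one (by simp)]

theorem atomTerm_inr_inl {W : ℕ} (G : Distr d) (ψ : Schw d) (n : ℕ) :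
    atomTerm (W := W) G ψ (.inr (.inl n)) = ((2 : ℝ) ^ (n : ℤ)) ^ 2
      * G (taylorRem W ψ (rescale (dyadic n) (potential d))) := by
  have h0 : ((2 : ℝ) ^ (-(n : ℤ))) ^ W ≠ 0 := by positivity
  simp only [atomTerm, atomWeight, atomExp, atom]
  rw [← rescaleL_apply, map_smul, map_smul, rescaleL_apply, ← rescale_taylorRem,
    rescale_dyadic_dyadic, add_neg_cancel, rescale_one (by simp), smul_eq_mul, mul_assoc,
    mul_inv_cancel_left₀ h0]

theorem atomTerm_inr_inr {W : ℕ} (G : Distr d) (ψ : Schw d) (s : words d W) (j : ℕ) :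
    atomTerm (W := W) G ψ (.inr (.inr (s, j))) = -(taylorCoeff s.1 * moment s.1 ψ) *
      (((2 : ℝ) ^ (-(j + 1 : ℤ))) ^ 2
        * G (wordD s.1 (rescale (dyadic (-(j + 1 : ℤ))) (potential d)))) := by
  simp only [atomTerm, atomWeight, atomExp, atom]
  rw [wordD_rescale, ← rescaleL_apply, map_smul, map_smul, rescaleL_apply, map_smul, smul_eq_mul,
    smul_eq_mul, coe_dyadic]
  ring

/-- The representation formula: a distribution `U` solving the equation with right-hand side `G`
is the sum of the contributions of the atoms, provided the boundary terms of the telescoping sums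
vanish. -/
theorem hasSum_atomTerm {U G : Distr d} (hUG : ∀ φ, Good φ → U (heat φ) = G φ) (W : ℕ)
    (ψ : Schw d) (hsum : Summable fun i : AtomIdx d W => atomTerm G ψ i)
    (hlarge : Tendsto (fun n : ℕ => U (taylorRem W ψ (rescale (dyadic n) (kernel d)))) atTop (𝓝 0))
    (hsmall : ∀ s ∈ words d W, Tendsto (fun k => U (wordD s (smallKernel d k))) atTop (𝓝 0)) :
    HasSum (fun i : AtomIdx d W => atomTerm G ψ i) (U ψ) := by
  have hA := hsum.comp_injective Sum.inl_injective
  have hR := hsum.comp_injective Sum.inr_injective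
  have hB := hR.comp_injective Sum.inl_injective
  have hC := hR.comp_injective Sum.inr_injective
  have hA' : HasSum ((fun i : AtomIdx d W => atomTerm G ψ i) ∘ Sum.inl)
      (U ψ - U (conv ψ (smallKernel d 0))) := by
    simp only [Function.comp_def, atomTerm_inl] at hA ⊢
    refine hasSum_small hUG (conv ψ) (heat_conv ψ) (fun φ h => h.conv ψ) ?_ hA
    exact (tendsto_apply_conv_smallKernel U ψ).congr fun k => by rw [conv_comm]
  have hB' : HasSum (((fun i : AtomIdx d W => atomTerm G ψ i) ∘ Sum.inr) ∘ Sum.inl)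
      (U (taylorRem W ψ (smallKernel d 0))) := by
    simp only [Function.comp_def, atomTerm_inr_inl] at hB ⊢
    exact hasSum_large hUG (taylorRem W ψ) (heat_taylorRem W ψ) (fun φ h => h.taylorRem W ψ)
      hlarge hB
  have hC' : HasSum (((fun i : AtomIdx d W => atomTerm G ψ i) ∘ Sum.inr) ∘ Sum.inr)
      (∑ s : words d W, taylorCoeff s.1 * moment s.1 ψ * U (wordD s.1 (smallKernel d 0))) := by
    have hfib : ∀ s : words d W, HasSum (fun j : ℕ =>
        (((fun i : AtomIdx d W => atomTerm G ψ i) ∘ Sum.inr) ∘ Sum.inr) (s, j))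
        (taylorCoeff s.1 * moment s.1 ψ * U (wordD s.1 (smallKernel d 0))) := by
      intro s
      have hs := hC.comp_injective (Prod.mk_right_injective s)
      simp only [Function.comp_def, atomTerm_inr_inr] at hs ⊢
      set c := taylorCoeff s.1 * moment s.1 ψ with hc
      -- If the coefficient of the word vanishes, nothing is known about the series without it.
      by_cases hc0 : c = 0
      · simp [hc0]
      · have hs' := (summable_mul_left_iff (neg_ne_zero.2 hc0)).1 hs
        have := (hasSum_small hUG (wordD s.1) (heat_wordD s.1) (fun φ h => h.wordD s.1)
          (hsmall s.1 s.2) hs').mul_left (-c)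
        rw [zero_sub, neg_mul_neg] at this
        exact this
    have h1 := hC.hasSum
    have h2 := h1.prod_fiberwise hfib
    rwa [h2.unique (hasSum_fintype _)] at h1
  have hall := hA'.sum (hB'.sum hC')
  -- The values at scale one of the three telescoping sums cancel by definition of `taylorRem`.
  have hval : U ψ - U (conv ψ (smallKernel d 0)) + (U (taylorRem W ψ (smallKernel d 0))
      + ∑ s : words d W, taylorCoeff s.1 * moment s.1 ψ * U (wordD s.1 (smallKernel d 0)))
      = U ψ := by
    rw [taylorRem_eq, map_sub, map_sum,
      Finset.sum_coe_sort (words d W)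
        fun s => taylorCoeff s * moment s ψ * U (wordD s (smallKernel d 0))]
    simp only [map_smul, smul_eq_mul]
    ring
  rwa [hval] at hall

theorem exists_abs_moment_le (s : List (Fin (d + 1))) {B : Set (Schw d)}
    (hB : Bornology.IsVonNBounded ℝ B) : ∃ C : ℝ, 0 ≤ C ∧ ∀ ψ ∈ B, |moment s ψ| ≤ C := by
  obtain ⟨C, hC0, hC⟩ := exists_decay_of_isVonNBounded hB (d + 2 + s.length)
  refine ⟨C * ∫ x : SpaceTime d, ((1 + ‖x‖) ^ (d + 2))⁻¹,
    mul_nonneg hC0 (integral_nonneg fun x => by positivity), fun ψ hψ => ?_⟩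
  rw [moment, ← integral_const_mul, ← Real.norm_eq_abs]
  refine norm_integral_le_of_norm_le (integrable_inv_bracket.const_mul _)
    (Eventually.of_forall fun y => ?_)
  rw [Real.norm_eq_abs, abs_mul, ← div_eq_mul_inv, le_div_iff₀ (by positivity)]
  calc |wordPow s y| * |ψ y| * (1 + ‖y‖) ^ (d + 2)
      ≤ (1 + ‖y‖) ^ s.length * |ψ y| * (1 + ‖y‖) ^ (d + 2) := by
        gcongr
        exact abs_wordPow_le s y
    _ = (1 + ‖y‖) ^ (d + 2 + s.length) * |ψ y| := by rw [pow_add _ (d + 2)]; ring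
    _ ≤ C := hC ψ hψ y

theorem isVonNBounded_atoms (W : ℕ) {B : Set (Schw d)} (hB : Bornology.IsVonNBounded ℝ B) :
    Bornology.IsVonNBounded ℝ {φ : Schw d | ∃ ψ ∈ B, ∃ i : AtomIdx d W, φ = atom ψ i} := by
  have h1 := isVonNBounded_taylorRem 0 (Bornology.isVonNBounded_singleton (potential d)) hB
  have h2 := isVonNBounded_taylorRem W hB (Bornology.isVonNBounded_singleton (potential d))
  have h3 : Bornology.IsVonNBounded ℝ {φ : Schw d | ∃ ψ ∈ B, ∃ s : words d W,
      φ = (-(taylorCoeff s.1 * moment s.1 ψ)) • wordD s.1 (potential d)} := by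
    rw [isVonNBounded_iff_wordD]
    intro t N
    choose C hC0 hC using fun s : words d W => exists_abs_moment_le s.1 hB
    choose C' hC'0 hC' using fun s : words d W => exists_decay (wordD t (wordD s.1 (potential d))) N
    have hnn : ∀ s, 0 ≤ |taylorCoeff s.1| * C s * C' s := fun s =>
      mul_nonneg (mul_nonneg (abs_nonneg _) (hC0 s)) (hC'0 s)
    refine ⟨∑ s, |taylorCoeff s.1| * C s * C' s, ?_⟩
    rintro φ ⟨ψ, hψ, s, rfl⟩ x
    refine le_trans ?_ (Finset.single_le_sum (fun s _ => hnn s) (Finset.mem_univ s))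
    rw [map_smul, smul_apply, smul_eq_mul, abs_mul, abs_neg, abs_mul]
    calc (1 + ‖x‖) ^ N * (|taylorCoeff s.1| * |moment s.1 ψ| *
            |wordD t (wordD s.1 (potential d)) x|)
        = |taylorCoeff s.1| * |moment s.1 ψ| *
            ((1 + ‖x‖) ^ N * |wordD t (wordD s.1 (potential d)) x|) := by ring
      _ ≤ |taylorCoeff s.1| * C s * C' s := by
          have := hC0 s
          gcongr
          · exact hC s ψ hψ
          · exact hC' s x
  refine ((h1.union h2).union h3).subset ?_
  rintro φ ⟨ψ, hψ, i, rfl⟩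
  have hle : ∀ k : ℕ, (2 : ℝ) ^ (-(k : ℤ)) ≤ 1 := coe_dyadic_neg_le_one
  rcases i with j | n | ⟨s, j⟩
  · -- For `W = 0` the Taylor remainder is the convolution itself.
    refine Or.inl (Or.inl ⟨potential d, rfl, ψ, hψ, dyadic (-((j + 1 : ℕ) : ℤ)),
      coe_dyadic_neg_le_one _, ?_⟩)
    simp [atom, taylorRem_eq, words_zero, conv_comm ψ]
  · exact Or.inl (Or.inr ⟨ψ, hψ, potential d, rfl, dyadic (-(n : ℤ)), coe_dyadic_neg_le_one _, rfl⟩)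
  · exact Or.inr ⟨ψ, hψ, s, rfl⟩

/-- The order up to which the Taylor expansion is subtracted at regularity `κ`. It is zero for negative
`κ`, in which case there are no Taylor terms. -/
def taylorOrder (κ : ℝ) : ℕ := (⌊κ⌋ + 1).toNat

theorem lt_taylorOrder (κ : ℝ) : κ < taylorOrder κ := by
  have h1 := Int.lt_floor_add_one κ
  have h2 : ((⌊κ⌋ + 1 : ℤ) : ℝ) ≤ (((⌊κ⌋ + 1).toNat : ℤ) : ℝ) :=
    Int.cast_le.2 (Int.self_le_toNat _)
  push_cast at h2
  exact h1.trans_le h2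

theorem order_lt_of_mem_words_taylorOrder {κ : ℝ} (hκ : ∀ n : ℕ, κ ≠ n)
    {s : List (Fin (d + 1))} (hs : s ∈ words d (taylorOrder κ)) : (order s : ℝ) < κ := by
  have h1 := order_lt_of_mem_words hs
  have h2 : (order s : ℤ) ≤ ⌊κ⌋ := by
    rw [taylorOrder] at h1
    omega
  have h3 : ((order s : ℤ) : ℝ) ≤ κ := Int.le_floor.1 h2
  exact lt_of_le_of_ne (by exact_mod_cast h3) (hκ _).symm

theorem summable_two_rpow_neg {a : ℝ} (ha : 0 < a) :
    Summable fun j : ℕ => ((2 : ℝ) ^ (-a)) ^ j :=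
  summable_geometric_of_lt_one (by positivity)
    (Real.rpow_lt_one_of_one_lt_of_neg one_lt_two (by linarith))

/-- The moment of the atoms of homogeneity `κ - 2` is finite: the three families contribute geometric
series with exponents `2`, `taylorOrder κ - κ` and `κ - order s`. -/
theorem summable_atomWeight {κ : ℝ} (hκ : ∀ n : ℕ, κ ≠ n) :
    Summable fun i : AtomIdx d (taylorOrder κ) =>
      atomWeight i * ((2 : ℝ) ^ (atomExp i)) ^ (κ - 2) := by
  have hz : ∀ (k : ℤ), (2 : ℝ) ^ k = (2 : ℝ) ^ (k : ℝ) := fun k => (Real.rpow_intCast 2 k).symm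
  have hn : ∀ (x : ℝ) (n : ℕ), x ^ n = x ^ (n : ℝ) := fun x n => (Real.rpow_natCast x n).symm
  have h2 : (0 : ℝ) ≤ 2 := by norm_num
  have h2' : (0 : ℝ) < 2 := by norm_num
  refine Summable.sum (f := fun i : AtomIdx d (taylorOrder κ) =>
      atomWeight i * ((2 : ℝ) ^ (atomExp i)) ^ (κ - 2)) ?_ (Summable.sum (f := fun i :
      ℕ ⊕ (words d (taylorOrder κ) × ℕ) => atomWeight (d := d) (W := taylorOrder κ) (.inr i) *
        ((2 : ℝ) ^ (atomExp (d := d) (W := taylorOrder κ) (.inr i))) ^ (κ - 2)) ?_ ?_)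
  · refine ((summable_two_rpow_neg (a := 2) (by norm_num)).mul_left ((2 : ℝ) ^ (-2 : ℝ))).congr
      fun j => ?_
    simp only [atomWeight, atomExp, Function.comp_def, zpow_zero, Real.one_rpow, mul_one]
    rw [hz, hn, hn, ← Real.rpow_mul h2, ← Real.rpow_mul h2, ← Real.rpow_add h2']
    congr 1
    push_cast
    ring
  · refine (summable_two_rpow_neg (a := taylorOrder κ - κ)
      (sub_pos.2 (lt_taylorOrder κ))).congr fun n => ?_
    simp only [atomWeight, atomExp, Function.comp_def]
    rw [hz, hz, hn, hn, hn, ← Real.rpow_mul h2, ← Real.rpow_mul h2, ← Real.rpow_mul h2,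
      ← Real.rpow_mul h2, ← Real.rpow_add h2', ← Real.rpow_add h2']
    congr 1
    push_cast
    ring
  · have hnn : ∀ q : words d (taylorOrder κ) × ℕ, 0 ≤ atomWeight (d := d) (W := taylorOrder κ)
        (.inr (.inr q)) * ((2 : ℝ) ^ (atomExp (d := d) (W := taylorOrder κ) (.inr (.inr q))))
          ^ (κ - 2) := fun q => mul_nonneg (atomWeight_nonneg _) (by positivity)
    refine (summable_prod_of_nonneg hnn).2 ⟨fun s => ?_, (hasSum_fintype _).summable⟩
    have hs := order_lt_of_mem_words_taylorOrder hκ s.2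
    refine ((summable_two_rpow_neg (a := κ - order s.1) (sub_pos.2 hs)).mul_left
      ((2 : ℝ) ^ (-(κ - order s.1)))).congr fun j => ?_
    simp only [atomWeight, atomExp]
    rw [hz, hn, hn, hn, ← Real.rpow_mul h2, ← Real.rpow_mul h2, ← Real.rpow_mul h2,
      ← Real.rpow_mul h2, ← Real.rpow_neg h2, ← Real.rpow_add h2', ← Real.rpow_add h2',
      ← Real.rpow_add h2']
    congr 1
    push_cast
    ring

/-! ### The representing measure -/

/-- The exponent of the smallest dyadic scale that is not below `r`. -/
def logScale (r : Scale) : ℤ := Int.clog 2 (r : ℝ)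

/-- The ratio of a scale `r` to the smallest dyadic scale that is not below it. -/
def fracScale (r : Scale) : Scale :=
  ⟨(r : ℝ) / (2 : ℝ) ^ logScale r, Set.mem_Ioi.2 (div_pos r.2 (zpow_pos two_pos _))⟩

theorem coe_fracScale (r : Scale) : (fracScale r : ℝ) = (r : ℝ) / (2 : ℝ) ^ logScale r := rfl

theorem fracScale_le_one (r : Scale) : (fracScale r : ℝ) ≤ 1 := by
  rw [coe_fracScale, div_le_one (by positivity)]
  exact_mod_cast Int.self_le_zpow_clog one_lt_two (r : ℝ)

theorem inv_fracScale_le_two (r : Scale) : (fracScale r : ℝ)⁻¹ ≤ 2 := by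
  have h := (Int.zpow_pred_clog_lt_self (b := 2) one_lt_two (Set.mem_Ioi.1 r.2)).le
  rw [coe_fracScale, inv_div, div_le_iff₀ r.2]
  rw [zpow_sub_one₀ (by norm_num), Nat.cast_ofNat, ← div_eq_mul_inv, div_le_iff₀ two_pos] at h
  rwa [mul_comm]

theorem rescale_fracScale (r : Scale) (ψ : Schw d) :
    rescale r ψ = rescale (dyadic (logScale r)) (rescale (fracScale r) ψ) := by
  rw [rescale_rescale (t := r)]
  rw [coe_dyadic, coe_fracScale, mul_div_cancel₀]
  positivity

/-- Rescaling by comparable scales preserves boundedness. -/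
theorem isVonNBounded_rescale {B : Set (Schw d)} (hB : Bornology.IsVonNBounded ℝ B) :
    Bornology.IsVonNBounded ℝ {φ : Schw d | ∃ ψ ∈ B, ∃ r : Scale, φ = rescale (fracScale r) ψ} := by
  rw [isVonNBounded_iff_wordD]
  intro s N
  obtain ⟨C, hC⟩ := isVonNBounded_iff_wordD.1 hB s N
  refine ⟨2 ^ order s * 2 ^ (d + 2) * C, ?_⟩
  rintro φ ⟨ψ, hψ, r, rfl⟩ x
  have h2 := inv_fracScale_le_two r
  have h0 : 0 ≤ (fracScale r : ℝ)⁻¹ := inv_nonneg.2 (le_of_lt (fracScale r).2)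
  have hx := le_dilation_symm_norm (fracScale_le_one r) x
  rw [wordD_rescale, smul_apply, rescale_apply', smul_eq_mul, abs_mul, abs_mul, ← inv_pow,
    ← inv_pow, abs_of_nonneg (by positivity), abs_of_nonneg (by positivity)]
  calc (1 + ‖x‖) ^ N * ((fracScale r : ℝ)⁻¹ ^ order s * ((fracScale r : ℝ)⁻¹ ^ (d + 2)
          * |wordD s ψ ((dilation d (fracScale r)).symm x)|))
      ≤ (1 + ‖(dilation d (fracScale r)).symm x‖) ^ N * (2 ^ order s * (2 ^ (d + 2)
          * |wordD s ψ ((dilation d (fracScale r)).symm x)|)) := by gcongr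
    _ = 2 ^ order s * 2 ^ (d + 2) * ((1 + ‖(dilation d (fracScale r)).symm x‖) ^ N
          * |wordD s ψ ((dilation d (fracScale r)).symm x)|) := by ring
    _ ≤ 2 ^ order s * 2 ^ (d + 2) * C := by
        gcongr
        exact hC ψ hψ _

/-- The representing measure: a countable superposition of Dirac masses. The test function is first
rescaled to a scale comparable to one, and the atoms are then moved by the corresponding power of
two. -/
def atomMeasure (W : ℕ) (ψ : Schw d) (r : Scale) : Measure (Schw d × Scale) :=
  Measure.sum fun i : AtomIdx d W =>
    ENNReal.ofReal (((2 : ℝ) ^ logScale r) ^ 2 * atomWeight i) •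
      Measure.dirac (atom (rescale (fracScale r) ψ) i, dyadic (logScale r + atomExp i))

theorem zpow_logScale_rpow_le (κ : ℝ) (r : Scale) :
    ((2 : ℝ) ^ logScale r) ^ κ ≤ (2 : ℝ) ^ |κ| * (r : ℝ) ^ κ := by
  have hr : (0 : ℝ) < r := r.2
  have hf : (0 : ℝ) < fracScale r := (fracScale r).2
  have h1 : (2 : ℝ) ^ logScale r = (fracScale r : ℝ)⁻¹ * r := by
    rw [coe_fracScale, inv_div, div_mul_cancel₀ _ hr.ne']
  have h2 : 1 ≤ (fracScale r : ℝ)⁻¹ := (one_le_inv₀ hf).2 (fracScale_le_one r)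
  rw [h1, Real.mul_rpow (by positivity) hr.le]
  gcongr
  calc (fracScale r : ℝ)⁻¹ ^ κ ≤ (fracScale r : ℝ)⁻¹ ^ |κ| :=
        Real.rpow_le_rpow_of_exponent_le h2 (le_abs_self κ)
    _ ≤ 2 ^ |κ| := Real.rpow_le_rpow (by positivity) (inv_fracScale_le_two r) (abs_nonneg κ)

theorem zpow_add_rpow (l k : ℤ) (a : ℝ) :
    ((2 : ℝ) ^ (l + k)) ^ a = ((2 : ℝ) ^ l) ^ a * ((2 : ℝ) ^ k) ^ a := by
  rw [zpow_add₀ two_ne_zero, Real.mul_rpow (by positivity) (by positivity)]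

theorem sq_mul_rpow_sub_two (l : ℤ) (κ : ℝ) :
    ((2 : ℝ) ^ l) ^ 2 * ((2 : ℝ) ^ l) ^ (κ - 2) = ((2 : ℝ) ^ l) ^ κ := by
  have h0 : (0 : ℝ) < (2 : ℝ) ^ l := by positivity
  rw [← Real.rpow_natCast, ← Real.rpow_add h0]
  congr 1
  push_cast
  ring

/-- The moments scale like `2 ^ (logScale r * κ)`, which is comparable to `r ^ κ`. -/
theorem exists_lintegral_atomMeasure_le {κ : ℝ} (hκ : ∀ n : ℕ, κ ≠ n) :
    ∃ C : ℝ, ∀ (ψ : Schw d) (r : Scale),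
      ∫⁻ q, ENNReal.ofReal ((q.2 : ℝ) ^ (κ - 2)) ∂(atomMeasure (taylorOrder κ) ψ r)
        ≤ ENNReal.ofReal (C * (r : ℝ) ^ κ) := by
  have hsum := summable_atomWeight (d := d) hκ
  have hnn : ∀ i : AtomIdx d (taylorOrder κ),
      0 ≤ atomWeight i * ((2 : ℝ) ^ (atomExp i)) ^ (κ - 2) := fun i =>
    mul_nonneg (atomWeight_nonneg i) (by positivity)
  set M := ∑' i : AtomIdx d (taylorOrder κ), atomWeight i * ((2 : ℝ) ^ (atomExp i)) ^ (κ - 2)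
  have hM : 0 ≤ M := tsum_nonneg hnn
  refine ⟨2 ^ |κ| * M, fun ψ r => ?_⟩
  have hterm : ∀ i : AtomIdx d (taylorOrder κ),
      ENNReal.ofReal (((2 : ℝ) ^ logScale r) ^ 2 * atomWeight i) *
        ENNReal.ofReal (((2 : ℝ) ^ (logScale r + atomExp i)) ^ (κ - 2))
      = ENNReal.ofReal (((2 : ℝ) ^ logScale r) ^ κ) *
        ENNReal.ofReal (atomWeight i * ((2 : ℝ) ^ (atomExp i)) ^ (κ - 2)) := by
    intro i
    have := atomWeight_nonneg i
    rw [← ENNReal.ofReal_mul (by positivity), ← ENNReal.ofReal_mul (by positivity), zpow_add_rpow,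
      ← sq_mul_rpow_sub_two _ κ]
    congr 1
    ring
  rw [atomMeasure, lintegral_sum_measure]
  simp only [lintegral_smul_measure, lintegral_dirac, smul_eq_mul, coe_dyadic, hterm]
  rw [ENNReal.tsum_mul_left, ← ENNReal.ofReal_tsum_of_nonneg hnn hsum,
    ← ENNReal.ofReal_mul (by positivity)]
  refine ENNReal.ofReal_le_ofReal ?_
  calc ((2 : ℝ) ^ logScale r) ^ κ * M ≤ 2 ^ |κ| * (r : ℝ) ^ κ * M := by
        gcongr
        exact zpow_logScale_rpow_le κ r
    _ = 2 ^ |κ| * M * (r : ℝ) ^ κ := by ring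

/-! ### Almost sure summability -/

/-- A random distribution with an annealed scaling bound can be summed, almost surely, along any
family of test functions from a bounded set whose scales have a finite moment. -/
theorem AnnealedScalingBound.ae_summable {Ω : Type*} [MeasurableSpace Ω] {P : Measure Ω}
    [IsProbabilityMeasure P] {p a : ℝ} {F : Ω → Distr d} (hF : AnnealedScalingBound P p a F)
    (hp : 1 < p) (hm : IsRandomDistr F) {B : Set (Schw d)} (hB : Bornology.IsVonNBounded ℝ B)
    {ι : Type*} [Countable ι] {c : ι → ℝ} {k : ι → ℤ} (hc : ∀ i, 0 ≤ c i)
    (hsum : Summable fun i => c i * ((2 : ℝ) ^ k i) ^ a) :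
    ∀ᵐ ω ∂P, ∀ φ : ι → Schw d, (∀ i, φ i ∈ B) →
      Summable fun i => c i * convZero (F ω) (rescale (dyadic (k i)) (φ i)) := by
  have hpos : ∀ (j : ℤ), (0 : ℝ) < (2 : ℝ) ^ j := fun j => by positivity
  obtain ⟨C, X, hX, hXF, hXC⟩ := exists_uniform_domination P
    (fun (j : ℤ) ω => ((2 : ℝ) ^ j) ^ (-a) • (F ω).comp (refl.comp (rescaleL (dyadic j))))
    (fun j φ => (hm _).const_mul _) (by
      intro B' hB'
      obtain ⟨C, hC⟩ := hF B' hB'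
      refine ⟨C, fun φ hφ j => le_trans ?_ (hC φ hφ (dyadic j))⟩
      -- On a probability space, the moment of order `p` controls the first moment.
      have h1 := eLpNorm'_le_eLpNorm'_of_exponent_le one_pos hp.le P
        (hm (refl (rescale (dyadic j) φ))).aestronglyMeasurable
      have h2 : ∀ ω, ENNReal.ofReal (|convZero (F ω) (rescale (dyadic j) φ)| ^ p)
          = ‖F ω (refl (rescale (dyadic j) φ))‖ₑ ^ p := fun ω => by
        rw [Real.enorm_eq_ofReal_abs, ENNReal.ofReal_rpow_of_nonneg (abs_nonneg _)
          (by linarith), convZero_eq]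
      have h3 : ∀ ω, ENNReal.ofReal |(((2 : ℝ) ^ j) ^ (-a) •
          (F ω).comp (refl.comp (rescaleL (dyadic j)))) φ|
          = ENNReal.ofReal (((2 : ℝ) ^ j) ^ (-a)) *
            ‖F ω (refl (rescale (dyadic j) φ))‖ₑ := fun ω => by
        rw [Real.enorm_eq_ofReal_abs, ← ENNReal.ofReal_mul (by positivity)]
        congr 1
        exact (abs_mul _ _).trans (by rw [abs_of_nonneg (by positivity)]; rfl)
      simp only [h2, h3]
      rw [lintegral_const_mul _ (hm _).enorm]
      simp only [eLpNorm', ENNReal.rpow_one, div_one] at h1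
      exact mul_le_mul_right h1 _) hB
  -- `X j` dominates the distribution at scale `2 ^ j`, normalised by `2 ^ (-j * a)`, on all of `B`.
  -- The sum of these bounds over the family has a finite expectation.
  have hfin : ∫⁻ ω, ∑' i, ENNReal.ofReal (c i * ((2 : ℝ) ^ k i) ^ a) * X (k i) ω ∂P ≠ ∞ := by
    rw [lintegral_tsum fun i => ((hX _).const_mul _).aemeasurable]
    refine ne_top_of_le_ne_top (b := ∑' i, ENNReal.ofReal (c i * ((2 : ℝ) ^ k i) ^ a) *
      ENNReal.ofReal C) ?_ (ENNReal.tsum_le_tsum fun i => ?_)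
    · rw [ENNReal.tsum_mul_right]
      exact ENNReal.mul_ne_top hsum.tsum_ofReal_ne_top ENNReal.ofReal_ne_top
    · rw [lintegral_const_mul _ (hX _)]
      gcongr
      exact hXC _
  filter_upwards [ae_lt_top' (AEMeasurable.tsum fun i =>
    ((hX _).const_mul _).aemeasurable) hfin] with ω hω φ hφ
  have h1 : ∑' i, ‖c i * convZero (F ω) (rescale (dyadic (k i)) (φ i))‖ₑ ≠ ∞ := by
    refine ne_top_of_le_ne_top hω.ne (ENNReal.tsum_le_tsum fun i => ?_)
    have h2 := hXF (k i) ω (φ i) (hφ i)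
    have h3 : c i * convZero (F ω) (rescale (dyadic (k i)) (φ i))
        = c i * ((2 : ℝ) ^ k i) ^ a * (((2 : ℝ) ^ k i) ^ (-a) •
          (F ω).comp (refl.comp (rescaleL (dyadic (k i))))) (φ i) := by
      have h4 : ((2 : ℝ) ^ k i) ^ a * ((2 : ℝ) ^ k i) ^ (-a) = 1 := by
        rw [← Real.rpow_add (hpos _), add_neg_cancel, Real.rpow_zero]
      calc c i * convZero (F ω) (rescale (dyadic (k i)) (φ i))
          = c i * (((2 : ℝ) ^ k i) ^ a * ((2 : ℝ) ^ k i) ^ (-a)) *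
            convZero (F ω) (rescale (dyadic (k i)) (φ i)) := by rw [h4, mul_one]
        _ = c i * ((2 : ℝ) ^ k i) ^ a * (((2 : ℝ) ^ k i) ^ (-a) *
            convZero (F ω) (rescale (dyadic (k i)) (φ i))) := by ring
    have h5 := mul_nonneg (hc i) (Real.rpow_nonneg (hpos (k i)).le a)
    rw [h3, enorm_mul, Real.enorm_eq_ofReal h5, Real.enorm_eq_ofReal_abs]
    gcongr
  have h6 := ENNReal.summable_toReal h1
  simp only [toReal_enorm] at h6
  exact h6.of_norm

/-! ### The representation -/

/-- The distribution `F` tested at the scale `2 ^ l`. -/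
def zoom (l : ℤ) (F : Distr d) : Distr d := F.comp (refl.comp (rescaleL (dyadic l)))

theorem zoom_apply (l : ℤ) (F : Distr d) (φ : Schw d) :
    zoom l F φ = convZero F (rescale (dyadic l) φ) := rfl

/-- The equation after parabolic rescaling. -/
theorem SolvesModPoly.zoom_heat {m : ℝ} {u f : Distr d} (h : SolvesModPoly m u f) (l : ℤ)
    {φ : Schw d} (hφ : Good φ) : zoom l u (heat φ) = (((2 : ℝ) ^ l) ^ 2 • zoom l f) φ := by
  have h1 := h.convZero_heat (hφ.rescale (dyadic l))
  rw [heat_rescale, coe_dyadic, convZero_eq, map_smul, map_smul, smul_eq_mul,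
    inv_mul_eq_iff_eq_mul₀ (by positivity)] at h1
  exact h1

/-- The boundary terms of the telescoping sum over large scales vanish. -/
theorem ae_tendsto_zoom_large {Ω : Type*} [MeasurableSpace Ω] {P : Measure Ω}
    [IsProbabilityMeasure P] {p κ : ℝ} {u : Ω → Distr d} (hu : AnnealedScalingBound P p κ u)
    (hp : 1 < p) (hm : IsRandomDistr u) {B : Set (Schw d)} (hB : Bornology.IsVonNBounded ℝ B)
    {W : ℕ} (hW : κ < W) (l : ℤ) :
    ∀ᵐ ω ∂P, ∀ ψ ∈ B, Tendsto
      (fun n : ℕ => zoom l (u ω) (taylorRem W ψ (rescale (dyadic n) (kernel d)))) atTop (𝓝 0) := by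
  have hb := isVonNBounded_taylorRem W hB (Bornology.isVonNBounded_singleton (kernel d))
  have hsum : Summable fun n : ℕ => ((2 : ℝ) ^ (-(n : ℤ))) ^ W * ((2 : ℝ) ^ (l + n)) ^ κ := by
    refine ((summable_two_rpow_neg (sub_pos.2 hW)).mul_left (((2 : ℝ) ^ l) ^ κ)).congr fun n => ?_
    rw [zpow_add_rpow, mul_left_comm, ← Real.rpow_intCast 2 (-(n : ℤ)), ← Real.rpow_intCast 2 (n : ℤ),
      ← Real.rpow_natCast, ← Real.rpow_natCast, ← Real.rpow_mul two_pos.le,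
      ← Real.rpow_mul two_pos.le, ← Real.rpow_mul two_pos.le, ← Real.rpow_add two_pos]
    congr 2
    push_cast
    ring
  filter_upwards [hu.ae_summable hp hm hb (fun n => by positivity) hsum] with ω hω ψ hψ
  refine (hω (fun n => (((2 : ℝ) ^ (-(n : ℤ))) ^ W)⁻¹ •
    taylorRem W (rescale (dyadic (-(n : ℤ))) ψ) (kernel d)) fun n =>
      ⟨ψ, hψ, kernel d, rfl, dyadic (-(n : ℤ)), coe_dyadic_neg_le_one n, rfl⟩
    ).tendsto_atTop_zero.congr fun n => ?_
  have h0 : ((2 : ℝ) ^ (-(n : ℤ))) ^ W ≠ 0 := by positivity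
  rw [← rescale_dyadic_dyadic, ← zoom_apply, ← rescaleL_apply (dyadic n), map_smul, map_smul,
    smul_eq_mul, mul_inv_cancel_left₀ h0, rescaleL_apply, ← rescale_taylorRem,
    rescale_dyadic_dyadic, add_neg_cancel, rescale_one (by simp)]

/-- The boundary terms of the telescoping sums over small scales vanish. -/
theorem ae_tendsto_zoom_small {Ω : Type*} [MeasurableSpace Ω] {P : Measure Ω}
    [IsProbabilityMeasure P] {p κ : ℝ} {u : Ω → Distr d} (hu : AnnealedScalingBound P p κ u)
    (hp : 1 < p) (hm : IsRandomDistr u) {s : List (Fin (d + 1))} (hs : (order s : ℝ) < κ) (l : ℤ) :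
    ∀ᵐ ω ∂P, Tendsto (fun k => zoom l (u ω) (wordD s (smallKernel d k))) atTop (𝓝 0) := by
  have hsum : Summable fun n : ℕ =>
      (((2 : ℝ) ^ (-(n : ℤ))) ^ order s)⁻¹ * ((2 : ℝ) ^ (l + -(n : ℤ))) ^ κ := by
    refine ((summable_two_rpow_neg (sub_pos.2 hs)).mul_left (((2 : ℝ) ^ l) ^ κ)).congr fun n => ?_
    rw [zpow_add_rpow, mul_left_comm, ← Real.rpow_intCast 2 (-(n : ℤ)), ← Real.rpow_natCast,
      ← Real.rpow_natCast, ← Real.rpow_mul two_pos.le,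
      ← Real.rpow_mul two_pos.le, ← Real.rpow_mul two_pos.le, ← Real.rpow_neg two_pos.le,
      ← Real.rpow_add two_pos]
    congr 2
    push_cast
    ring
  filter_upwards [hu.ae_summable hp hm (Bornology.isVonNBounded_singleton (wordD s (kernel d)))
    (fun n => by positivity) hsum] with ω hω
  refine (hω (fun _ => wordD s (kernel d)) fun _ => rfl).tendsto_atTop_zero.congr fun n => ?_
  rw [smallKernel_eq, wordD_rescale, map_smul, smul_eq_mul, coe_dyadic, zoom_apply,
    rescale_dyadic_dyadic]

/-- The bounded set of test functions on which the representing measures of a bounded set live.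
The closure makes it a Borel set. -/
def atomSet (W : ℕ) (B : Set (Schw d)) : Set (Schw d) :=
  closure {φ | ∃ ψ ∈ {φ : Schw d | ∃ ψ ∈ B, ∃ r : Scale, φ = rescale (fracScale r) ψ},
    ∃ i : AtomIdx d W, φ = atom ψ i}

theorem isVonNBounded_atomSet (W : ℕ) {B : Set (Schw d)} (hB : Bornology.IsVonNBounded ℝ B) :
    Bornology.IsVonNBounded ℝ (atomSet W B) :=
  (isVonNBounded_atoms W (isVonNBounded_rescale hB)).closure

theorem atom_mem_atomSet {W : ℕ} {B : Set (Schw d)} {ψ : Schw d} (hψ : ψ ∈ B) (r : Scale)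
    (i : AtomIdx d W) : atom (rescale (fracScale r) ψ) i ∈ atomSet W B :=
  subset_closure ⟨_, ⟨ψ, hψ, r, rfl⟩, i, rfl⟩

theorem restrict_atomMeasure {W : ℕ} {B : Set (Schw d)} {ψ : Schw d} (hψ : ψ ∈ B) (r : Scale) :
    (atomMeasure W ψ r).restrict (atomSet W B ×ˢ Set.univ) = atomMeasure W ψ r := by
  refine Measure.restrict_eq_self_of_ae_mem (Measure.ae_sum_iff.2 fun i => ?_)
  refine Measure.ae_smul_measure ?_ _
  rw [ae_dirac_eq]
  exact ⟨atom_mem_atomSet hψ r i, Set.mem_univ _⟩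

/-- The representation follows from the summation formula at all dyadic scales. -/
theorem representation_of_hasSum {W : ℕ} {B : Set (Schw d)} {u f : Distr d}
    (h : ∀ ψ ∈ B, ∀ r : Scale, HasSum (fun i : AtomIdx d W => atomTerm
        (((2 : ℝ) ^ logScale r) ^ 2 • zoom (logScale r) f) (rescale (fracScale r) ψ) i)
        (zoom (logScale r) u (rescale (fracScale r) ψ))) :
    Representation (atomMeasure W) B (atomSet W B) u f := by
  intro ψ hψ r
  have hs := h ψ hψ r
  have hw : ∀ i : AtomIdx d W, 0 ≤ ((2 : ℝ) ^ logScale r) ^ 2 * atomWeight i := fun i =>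
    mul_nonneg (by positivity) (atomWeight_nonneg i)
  have hterm : ∀ i : AtomIdx d W, atomTerm (((2 : ℝ) ^ logScale r) ^ 2 • zoom (logScale r) f)
      (rescale (fracScale r) ψ) i
      = (ENNReal.ofReal (((2 : ℝ) ^ logScale r) ^ 2 * atomWeight i)).toReal *
        convZero f (rescale (dyadic (logScale r + atomExp i))
          (atom (rescale (fracScale r) ψ) i)) := by
    intro i
    rw [ENNReal.toReal_ofReal (hw i), ← rescale_dyadic_dyadic, ← zoom_apply, atomTerm, smul_apply,
      smul_eq_mul]
    ring
  simp only [hterm] at hs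
  have hf : Summable fun i : AtomIdx d W =>
      (ENNReal.ofReal (((2 : ℝ) ^ logScale r) ^ 2 * atomWeight i)).toReal *
        ‖convZero f (rescale (dyadic (logScale r + atomExp i))
          (atom (rescale (fracScale r) ψ) i))‖ := by
    refine hs.summable.norm.congr fun i => ?_
    rw [norm_mul, Real.norm_of_nonneg ENNReal.toReal_nonneg]
  have hint := integrable_sum_dirac (f := fun q : Schw d × Scale => convZero f (rescale q.2 q.1))
    (x := fun i => (atom (rescale (fracScale r) ψ) i, dyadic (logScale r + atomExp i)))
    (fun i => ENNReal.ofReal_ne_top) hf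
  have hval := hasSum_integral_sum_dirac
    (f := fun q : Schw d × Scale => convZero f (rescale q.2 q.1))
    (x := fun i => (atom (rescale (fracScale r) ψ) i, dyadic (logScale r + atomExp i)))
    (fun i => ENNReal.ofReal_ne_top) hf
  rw [IntegrableOn, restrict_atomMeasure hψ, rescale_fracScale r ψ, ← zoom_apply]
  exact ⟨hint, hs.unique hval⟩

theorem ae_representation {Ω : Type*} [MeasurableSpace Ω] {P : Measure Ω}
    [IsProbabilityMeasure P] {p κ : ℝ} {u f : Ω → Distr d} (hκ : ∀ n : ℕ, κ ≠ n) (hp : 1 < p)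
    (hmu : IsRandomDistr u) (hmf : IsRandomDistr f)
    (hsol : ∀ᵐ ω ∂P, SolvesModPoly (κ - 2) (u ω) (f ω))
    (hf : AnnealedScalingBound P p (κ - 2) f) (hu : AnnealedScalingBound P p κ u)
    {B : Set (Schw d)} (hB : Bornology.IsVonNBounded ℝ B) :
    ∀ᵐ ω ∂P, Representation (atomMeasure (taylorOrder κ)) B (atomSet (taylorOrder κ) B)
      (u ω) (f ω) := by
  have hB₁ := isVonNBounded_rescale hB
  have hsum : ∀ l : ℤ, Summable fun i : AtomIdx d (taylorOrder κ) =>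
      ((2 : ℝ) ^ l) ^ 2 * atomWeight i * ((2 : ℝ) ^ (l + atomExp i)) ^ (κ - 2) := fun l => by
    refine ((summable_atomWeight (d := d) hκ).mul_left
      (((2 : ℝ) ^ l) ^ 2 * ((2 : ℝ) ^ l) ^ (κ - 2))).congr fun i => ?_
    rw [zpow_add_rpow]
    ring
  -- The exceptional sets are taken over the countably many dyadic scales, and not over `r` and `ψ`.
  have h1 := ae_all_iff.2 fun l : ℤ => hf.ae_summable hp hmf (isVonNBounded_atoms (taylorOrder κ) hB₁)
    (fun i => mul_nonneg (by positivity) (atomWeight_nonneg i)) (hsum l)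
  have h2 := ae_all_iff.2 fun l : ℤ =>
    ae_tendsto_zoom_large hu hp hmu hB₁ (lt_taylorOrder κ) l
  have h3 := ae_all_iff.2 fun l : ℤ => ae_all_iff.2 fun s : words d (taylorOrder κ) =>
    ae_tendsto_zoom_small hu hp hmu (order_lt_of_mem_words_taylorOrder hκ s.2) l
  filter_upwards [hsol, h1, h2, h3] with ω hω h1 h2 h3
  refine representation_of_hasSum fun ψ hψ r => ?_
  have hψ₁ : rescale (fracScale r) ψ ∈
      {φ : Schw d | ∃ ψ ∈ B, ∃ r : Scale, φ = rescale (fracScale r) ψ} := ⟨ψ, hψ, r, rfl⟩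
  refine hasSum_atomTerm (fun φ hφ => hω.zoom_heat _ hφ) _ _ ?_ (h2 _ _ hψ₁)
    fun s hs => h3 _ ⟨s, hs⟩
  refine (h1 (logScale r) (fun i => atom (rescale (fracScale r) ψ) i)
    fun i => ⟨_, hψ₁, i, rfl⟩).congr fun i => ?_
  rw [← rescale_dyadic_dyadic, ← zoom_apply, atomTerm, smul_apply, smul_eq_mul]
  ring

/-- A deterministic scaling bound is an annealed one for a one-point probability space. -/
theorem ScalingBound.annealedScalingBound {a p : ℝ} (hp : 1 < p) {F : Distr d}
    (h : ScalingBound a F) :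
    AnnealedScalingBound (Measure.dirac Unit.unit) p a fun _ => F := by
  intro B hB
  obtain ⟨C, hC⟩ := h B hB
  refine ⟨C, fun ψ hψ r => ?_⟩
  have hr : (0 : ℝ) ≤ (r : ℝ) ^ (-a) := Real.rpow_nonneg (le_of_lt r.2) _
  rw [lintegral_dirac, ENNReal.ofReal_rpow_of_nonneg (by positivity) (by positivity),
    ← Real.rpow_mul (abs_nonneg _), mul_one_div_cancel (by linarith), Real.rpow_one,
    ← ENNReal.ofReal_mul hr]
  exact ENNReal.ofReal_le_ofReal (hC ψ hψ r)

theorem SolvesModPoly.representation {κ : ℝ} {u f : Distr d} (hκ : ∀ n : ℕ, κ ≠ n)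
    (hsol : SolvesModPoly (κ - 2) u f) (hf : ScalingBound (κ - 2) f) (hu : ScalingBound κ u)
    {B : Set (Schw d)} (hB : Bornology.IsVonNBounded ℝ B) :
    Representation (atomMeasure (taylorOrder κ)) B (atomSet (taylorOrder κ) B) u f := by
  have h := ae_representation (P := Measure.dirac Unit.unit) (u := fun _ => u) (f := fun _ => f)
    hκ one_lt_two (fun _ => measurable_const) (fun _ => measurable_const)
    (Eventually.of_forall fun _ => hsol) (hf.annealedScalingBound one_lt_two)
    (hu.annealedScalingBound one_lt_two) hB
  rw [ae_dirac_eq] at h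
  exact h

end

end AbstractIntegration

theorem mainTheorem3 (d : ℕ) :
    ∃ μ : AbstractIntegration.Schw d → AbstractIntegration.Scale → ℝ →
        MeasureTheory.Measure (AbstractIntegration.Schw d × AbstractIntegration.Scale),
      -- representation, deterministic and annealed
      (∀ κ : ℝ, (∀ n : ℕ, κ ≠ n) →
        ∀ B : Set (AbstractIntegration.Schw d), Bornology.IsVonNBounded ℝ B →
          ∃ B' : Set (AbstractIntegration.Schw d),
            Bornology.IsVonNBounded ℝ B' ∧ MeasurableSet B' ∧
            (∀ u f : AbstractIntegration.Distr d,
              AbstractIntegration.SolvesModPoly (κ - 2) u f →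
              AbstractIntegration.ScalingBound (κ - 2) f →
              AbstractIntegration.ScalingBound κ u →
              AbstractIntegration.Representation (fun ψ r => μ ψ r κ) B B' u f) ∧
            (∀ (Ω : Type*) [MeasurableSpace Ω] (P : MeasureTheory.Measure Ω)
              [MeasureTheory.IsProbabilityMeasure P] (p : ℝ), 1 < p →
              ∀ u f : Ω → AbstractIntegration.Distr d,
              AbstractIntegration.IsRandomDistr u →
              AbstractIntegration.IsRandomDistr f →
              (∀ᵐ ω ∂P, AbstractIntegration.SolvesModPoly (κ - 2) (u ω) (f ω)) →
              AbstractIntegration.AnnealedScalingBound P p (κ - 2) f →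
              AbstractIntegration.AnnealedScalingBound P p κ u →
              ∀ᵐ ω ∂P,
                AbstractIntegration.Representation (fun ψ r => μ ψ r κ) B B' (u ω) (f ω))) ∧
      -- moment bounds
      (∀ κ κ' : ℝ, (∀ n : ℕ, κ ≠ n) → (∀ n : ℕ, κ' ≠ n) → ⌊κ⌋ = ⌊κ'⌋ →
        ∀ B : Set (AbstractIntegration.Schw d), Bornology.IsVonNBounded ℝ B →
          ∃ C : ℝ, ∀ ψ ∈ B, ∀ r : AbstractIntegration.Scale,
            ∫⁻ q, ENNReal.ofReal ((q.2 : ℝ) ^ (κ' - 2)) ∂(μ ψ r κ)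
              ≤ ENNReal.ofReal (C * (r : ℝ) ^ κ')) ∧
      -- dependence on the integer part only
      (∀ κ κ' : ℝ, (∀ n : ℕ, κ ≠ n) → (∀ n : ℕ, κ' ≠ n) → ⌊κ⌋ = ⌊κ'⌋ →
        ∀ (ψ : AbstractIntegration.Schw d) (r : AbstractIntegration.Scale),
          μ ψ r κ = μ ψ r κ') := by
  open AbstractIntegration in
  refine ⟨fun ψ r κ => atomMeasure (taylorOrder κ) ψ r, fun κ hκ B hB =>
    ⟨atomSet (taylorOrder κ) B, isVonNBounded_atomSet _ hB, isClosed_closure.measurableSet,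
      fun u f hsol hf hu => hsol.representation hκ hf hu hB,
      fun Ω _ P _ p hp u f hmu hmf hsol hf hu =>
        ae_representation hκ hp hmu hmf hsol hf hu hB⟩, ?_, ?_⟩
  · intro κ κ' _ hκ' hfl B _
    obtain ⟨C, hC⟩ := exists_lintegral_atomMeasure_le (d := d) hκ'
    refine ⟨C, fun ψ _ r => ?_⟩
    have h : taylorOrder κ = taylorOrder κ' := by rw [taylorOrder, taylorOrder, hfl]
    simp only [h]
    exact hC ψ r
  · intro κ κ' _ _ hfl ψ r
    simp only [taylorOrder, hfl]
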